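/- Let $M\subset\mathbb{R}^{n+d}$ be a compact, connected, smooth embedded $d$-dimensional submanifold without boundary (for example the zero set of a smooth map $\mathbb{R}^{n+d}\to\mathbb{R}^n$ having $0$ as a regular value), with the Riemannian metric and the volume measure that it inherits from $\mathbb{R}^{n+d}$. Let $C^\infty(M)$ be the algebra of smooth functions $M\to\mathbb{R}$, let $\|h\|_\infty=\sup_{x\in M}|h(x)|$, and let $\nabla_M f$ denote the gradient of $f\in C^\infty(M)$, a tangent vector field on $M$. For $x,y\in M$ let $$\mathrm{dist}_M(x,y)=\inf_\gamma\int_0^1\|\gamma'(t)\|\,dt,$$ the infimum over all smooth paths $\gamma:[0,1]\to\mathbb{R}^{n+d}$ from $x$ to $y$ whose image lies in $M$. Then there is a unique linear operator $\Delta_M:C^\infty(M)\to C^\infty(M)$ (the Laplace–Beltrami operator) such that $$\int_M f\,\Delta_M g=-\int_M\nabla_M f\cdot\nabla_M g\qquad\text{for all } f,g\in C^\infty(M),$$ and for all $x,y\in M$ $$\mathrm{dist}_M(x,y)=\sup_f|f(x)-f(y)|,$$ where the supremum is taken over all $f\in C^\infty(M)$ satisfying $\left\|\tfrac12\Delta_M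 (f^2)-f\,\Delta_M f\right\|_\infty\le 1$. -/

import Mathlib

open MeasureTheory
open scoped ContDiff

noncomputable section

/-- `M` is a smooth `d`-dimensional (embedded, boundaryless) submanifold of `ℝ^(n+d)`: near each of
its points it is the zero set of a smooth map `F` to `ℝ^n` whose zeros are not critical points, that
is, the derivative of `F` is onto at each zero of `F`. (With `U = Set.univ` this contains the zero
sets of globally defined such maps.) -/
def IsSmoothSubmanifold (n d : ℕ) (M : Set (EuclideanSpace ℝ (Fin (n + d)))) : Prop :=
  ∀ p ∈ M, ∃ (U : Set (EuclideanSpace ℝ (Fin (n + d))))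
    (F : EuclideanSpace ℝ (Fin (n + d)) → EuclideanSpace ℝ (Fin n)),
    IsOpen U ∧ p ∈ U ∧ ContDiffOn ℝ ∞ F U ∧
    (∀ y ∈ U, F y = 0 → Function.Surjective (fderiv ℝ F y)) ∧
    M ∩ U = {y ∈ U | F y = 0}

section

variable {N : ℕ}

/-- A map from a Euclidean space to `M ⊆ ℝ^N` is smooth if it is smooth as a map into `ℝ^N`. A
function `f : M → ℝ` is smooth if its composition with every smooth map from a Euclidean space
`ℝ^m` to `M` is smooth. -/
def IsSmoothFunction {M : Set (EuclideanSpace ℝ (Fin N))} (f : M → ℝ) : Prop :=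
  ∀ (m : ℕ) (i : EuclideanSpace ℝ (Fin m) → M),
    ContDiff ℝ ∞ (fun u => (i u : EuclideanSpace ℝ (Fin N))) → ContDiff ℝ ∞ (fun u => f (i u))

/-- The algebra `C^∞(M)` of smooth real-valued functions on `M`. -/
def SmoothFunctions (M : Set (EuclideanSpace ℝ (Fin N))) : Subalgebra ℝ (M → ℝ) where
  carrier := {f | IsSmoothFunction f}
  mul_mem' hf hg := fun m i hi => (hf m i hi).mul (hg m i hi)
  add_mem' hf hg := fun m i hi => (hf m i hi).add (hg m i hi)
  algebraMap_mem' _ := fun _ _ _ => contDiff_const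

/-- The uniform norm `‖h‖_∞ = sup_{x ∈ M} |h x|`, as an extended nonnegative real. -/
def uniformNorm {M : Set (EuclideanSpace ℝ (Fin N))} (h : M → ℝ) : ENNReal :=
  ⨆ x, ‖h x‖ₑ

/-- The intrinsic distance: the infimum of the lengths `∫₀¹ ‖γ'(t)‖ dt` of the smooth paths
`γ : [0, 1] → ℝ^N` from `x` to `y` whose image lies in `M`. -/
def intrinsicDist (M : Set (EuclideanSpace ℝ (Fin N))) (x y : M) : ℝ :=
  sInf {L : ℝ | ∃ γ : ℝ → EuclideanSpace ℝ (Fin N),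
    ContDiffOn ℝ ∞ γ (Set.Icc 0 1) ∧ (∀ t ∈ Set.Icc (0 : ℝ) 1, γ t ∈ M) ∧
    γ 0 = x ∧ γ 1 = y ∧
    L = ∫ t in (0 : ℝ)..1, ‖derivWithin γ (Set.Icc 0 1) t‖}

/-- A smooth curve `γ : ℝ → M` with `γ 0 = x`. -/
def IsSmoothCurveAt {M : Set (EuclideanSpace ℝ (Fin N))} (x : M) (γ : ℝ → M) : Prop :=
  ContDiff ℝ ∞ (fun t => (γ t : EuclideanSpace ℝ (Fin N))) ∧ γ 0 = x

/-- The velocity at time `0` of a curve in `M`. -/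
def velocity {M : Set (EuclideanSpace ℝ (Fin N))} (γ : ℝ → M) : EuclideanSpace ℝ (Fin N) :=
  deriv (fun t => (γ t : EuclideanSpace ℝ (Fin N))) 0

/-- The tangent space of `M` at `x`, as a subset of `ℝ^N`: the velocities at `x` of the smooth
curves in `M` through `x`. -/
def tangentVectors {M : Set (EuclideanSpace ℝ (Fin N))} (x : M) :
    Set (EuclideanSpace ℝ (Fin N)) :=
  {v | ∃ γ : ℝ → M, IsSmoothCurveAt x γ ∧ velocity γ = v}

/-- `v` is the gradient of `f` at `x`: a tangent vector whose inner product with the velocity of any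
smooth curve through `x` is the derivative of `f` along that curve. There is at most one such `v`,
and there is one if `f` is smooth and `M` is a smooth submanifold. -/
def IsGradientAt {M : Set (EuclideanSpace ℝ (Fin N))} (f : M → ℝ) (x : M)
    (v : EuclideanSpace ℝ (Fin N)) : Prop :=
  v ∈ tangentVectors x ∧
    ∀ γ : ℝ → M, IsSmoothCurveAt x γ → deriv (fun t => f (γ t)) 0 = inner ℝ v (velocity γ)

open Classical in
/-- The gradient `∇_M f`, with values in the tangent spaces of `M` regarded as subspaces of
`ℝ^N`. -/
def manifoldGradient {M : Set (EuclideanSpace ℝ (Fin N))} (f : M → ℝ) (x : M) :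
    EuclideanSpace ℝ (Fin N) :=
  if h : ∃ v, IsGradientAt f x v then h.choose else 0

/-- The integral of `f` over a `d`-dimensional submanifold `M ⊆ ℝ^N` with respect to the volume
measure that `M` inherits from `ℝ^N`, which is the `d`-dimensional Hausdorff measure normalized to
agree with Lebesgue measure on `ℝ^d`. -/
def volumeIntegral (d : ℕ) {M : Set (EuclideanSpace ℝ (Fin N))} (f : M → ℝ) : ℝ :=
  ∫ x : M, f x ∂(μHE[d] : Measure M)

/-- The identity `∫_M f Δg = - ∫_M ∇_M f · ∇_M g` for all `f, g ∈ C^∞(M)`, which characterizes the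
Laplace–Beltrami operator of `M` among the linear operators on `C^∞(M)`. -/
def IsLaplaceBeltrami (d : ℕ) {M : Set (EuclideanSpace ℝ (Fin N))}
    (Δ : SmoothFunctions M →ₗ[ℝ] SmoothFunctions M) : Prop :=
  ∀ f g : SmoothFunctions M,
    volumeIntegral d (fun x => f.1 x * (Δ g).1 x) =
      - volumeIntegral d (fun x => inner ℝ (manifoldGradient f.1 x) (manifoldGradient g.1 x))

end

end

/-! The operator enters the distance formula only through the carré du champ: testing against an
arbitrary smooth function and using the product rule gives `½ Δ(f²) - f Δf = |∇f|²`
(`HasCharts.carre_du_champ`), so the supremum runs over the smooth `f` with `|∇f| ≤ 1`.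

Along a path such an `f` changes by at most the length of the path (`HasCharts.sub_le_pathLength`),
which bounds the supremum by the distance. The natural extremal function `dist_M(x, ·)` is only
Lipschitz. At small scale, intrinsic and chordal distances agree up to a factor close to 1
(`Chart.exists_pathLength_le`), so this function is locally `(1 + ε)²`-Lipschitz for the ambient
norm. Local Lipschitz extension, mollification and a partition of unity then give a smooth function
within `ε` of it, with gradient at most `(1 + ε)² + ε` (`HasCharts.exists_smooth_approx`). Rescaling
and letting `ε → 0` gives equality.

For the existence of `Δ`, Hausdorff measure has a smooth positive density in every chart
(`Chart.comap_param_euclideanHausdorffMeasure`), so the divergence theorem of `ℝ^d` yields `div(χ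
∇g)` for `χ` supported in a chart, and a partition of unity sums these. Uniqueness and linearity
follow because nonempty open sets have positive volume, so that pairing with smooth functions
determines a smooth function. -/

noncomputable section

open MeasureTheory Set Filter Topology Metric
open scoped ContDiff

local notation "𝔼" n:max => EuclideanSpace ℝ (Fin n)

/-! ### Charts of an embedded submanifold -/

/-- A smooth parametrization of an open subset of `M` by all of `ℝ^d`, whose inverse extends to a
map that is smooth near that subset of the ambient space. -/
structure Chart {N : ℕ} (d : ℕ) (M : Set (𝔼 N)) where
  /-- the parametrization -/
  param : 𝔼 d → M
  /-- the coordinates, as a function on the ambient space -/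
  coord : 𝔼 N → 𝔼 d
  contDiff_param : ContDiff ℝ ∞ (fun u => (param u : 𝔼 N))
  coord_param : ∀ u, coord (param u) = u
  isOpen_range : IsOpen (range param)
  contDiffAt_coord : ∀ u, ContDiffAt ℝ ∞ coord (param u)

/-- `P` is the orthogonal projection onto `ker A`, which has dimension `d`. A vector killed by both
maps lies in `ker A` and equals its own projection, hence is `0`. This completes a submersion to a
local diffeomorphism. -/
theorem exists_complementary_projection {n d : ℕ} (A : 𝔼 (n + d) →L[ℝ] 𝔼 n)
    (hA : Function.Surjective A) :
    ∃ (P : 𝔼 (n + d) →L[ℝ] 𝔼 d) (e : 𝔼 (n + d) ≃L[ℝ] (𝔼 n × 𝔼 d)),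
      (e : 𝔼 (n + d) →L[ℝ] (𝔼 n × 𝔼 d)) = A.prod P := by
  let K : Submodule ℝ (𝔼 (n + d)) := LinearMap.ker (A : 𝔼 (n + d) →ₗ[ℝ] 𝔼 n)
  have hK : Module.finrank ℝ K = Module.finrank ℝ (𝔼 d) := by
    have h1 := LinearMap.finrank_range_add_finrank_ker (A : 𝔼 (n + d) →ₗ[ℝ] 𝔼 n)
    have h2 : LinearMap.range (A : 𝔼 (n + d) →ₗ[ℝ] 𝔼 n) = ⊤ := LinearMap.range_eq_top.2 hA
    rw [h2, finrank_top] at h1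
    simp only [finrank_euclideanSpace, Fintype.card_fin] at h1 ⊢
    change n + Module.finrank ℝ K = n + d at h1
    omega
  let i : K ≃L[ℝ] 𝔼 d := (LinearEquiv.ofFinrankEq _ _ hK).toContinuousLinearEquiv
  let P : 𝔼 (n + d) →L[ℝ] 𝔼 d := (i : K →L[ℝ] 𝔼 d) ∘L K.orthogonalProjectionOnto
  have hinj : Function.Injective (A.prod P : 𝔼 (n + d) →ₗ[ℝ] 𝔼 n × 𝔼 d) := by
    rw [injective_iff_map_eq_zero]
    intro y hy
    have hy' : (A y, P y) = 0 := hy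
    obtain ⟨h1, h2⟩ := Prod.mk_eq_zero.1 hy'
    have h1' : y ∈ K := h1
    have h3 : K.orthogonalProjectionOnto y = 0 := i.injective (by simpa [P] using h2)
    have h4 := K.orthogonalProjectionOnto_mem_subspace_eq_self ⟨y, h1'⟩
    rw [h3] at h4
    exact (congrArg Subtype.val h4).symm
  let e : 𝔼 (n + d) ≃ₗ[ℝ] 𝔼 n × 𝔼 d := LinearEquiv.ofInjectiveOfFinrankEq _ hinj (by simp)
  exact ⟨P, e.toContinuousLinearEquiv, by ext <;> rfl⟩

/-- The inverse function theorem, with the source shrunk to the open set where the derivative is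
invertible, so that the inverse is smooth on the whole target and not only at the image of `x`. -/
theorem exists_openPartialHomeomorph_of_contDiffOn {E F : Type*} [NormedAddCommGroup E]
    [NormedSpace ℝ E] [NormedAddCommGroup F] [NormedSpace ℝ F] [CompleteSpace E]
    {U : Set E} (hU : IsOpen U) {Φ : E → F} (hΦ : ContDiffOn ℝ ∞ Φ U) {x : E} (hx : x ∈ U)
    {e₀ : E ≃L[ℝ] F} (he₀ : HasFDerivAt Φ (e₀ : E →L[ℝ] F) x) :
    ∃ h : OpenPartialHomeomorph E F, x ∈ h.source ∧ h.source ⊆ U ∧ (∀ y, h y = Φ y) ∧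
      ∀ z ∈ h.target, ContDiffAt ℝ ∞ h.symm z := by
  have hΦat : ∀ y ∈ U, ContDiffAt ℝ ∞ Φ y := fun y hy => hΦ.contDiffAt (hU.mem_nhds hy)
  let h₀ := (hΦat x hx).toOpenPartialHomeomorph Φ he₀ (by simp)
  have hx₀ : x ∈ h₀.source := (hΦat x hx).mem_toOpenPartialHomeomorph_source he₀ (by simp)
  let O : Set (E →L[ℝ] F) := range ((↑) : (E ≃L[ℝ] F) → E →L[ℝ] F)
  have hV : IsOpen (U ∩ (fun y => fderiv ℝ Φ y) ⁻¹' O) :=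
    (hΦ.continuousOn_fderiv_of_isOpen hU (by simp)).isOpen_inter_preimage hU
      ContinuousLinearEquiv.isOpen
  refine ⟨h₀.restrOpen _ hV, ⟨hx₀, hx, e₀, he₀.fderiv.symm⟩, fun y hy => hy.2.1, fun y => rfl, ?_⟩
  intro z hz
  obtain ⟨hzU, e, he⟩ : h₀.symm z ∈ U ∩ (fun y => fderiv ℝ Φ y) ⁻¹' O :=
    ((h₀.restrOpen _ hV).map_target hz).2
  refine (h₀.restrOpen _ hV).contDiffAt_symm (f₀' := e) hz ?_ (hΦat _ hzU)
  rw [he]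
  exact ((hΦat _ hzU).differentiableAt (by simp)).hasFDerivAt

/-- The map `(F, P)` straightens `M` to the slice `{0} × ℝ^d`; the chart is its inverse on that
slice, and `P` recovers the coordinates. -/
theorem exists_chart {n d : ℕ} {M : Set (𝔼 (n + d))} (hM : IsSmoothSubmanifold n d M) (x : M) :
    ∃ c : Chart d M, x ∈ range c.param := by
  obtain ⟨U, F, hU, hxU, hF, hsurj, hMU⟩ := hM x x.2
  have hM0 : ∀ y ∈ M, y ∈ U → F y = 0 := fun y hy hyU =>
    ((hMU ▸ ⟨hy, hyU⟩ : y ∈ {y ∈ U | F y = 0})).2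
  have hM1 : ∀ y ∈ U, F y = 0 → y ∈ M := fun y hyU h0 =>
    ((hMU.symm ▸ ⟨hyU, h0⟩ : y ∈ M ∩ U)).1
  obtain ⟨P, e₀, he₀⟩ := exists_complementary_projection _ (hsurj x hxU (hM0 x x.2 hxU))
  have hx' : HasFDerivAt (fun y => (F y, P y)) (e₀ : 𝔼 (n + d) →L[ℝ] 𝔼 n × 𝔼 d) x := he₀ ▸
    ((hF.contDiffAt (hU.mem_nhds hxU)).differentiableAt (by simp)).hasFDerivAt.prodMk P.hasFDerivAt
  obtain ⟨h, hxh, hhU, hhΦ, hsymm⟩ := exists_openPartialHomeomorph_of_contDiffOn hU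
    (hF.prodMk P.contDiff.contDiffOn) hxU hx'
  have hT : IsOpen ((fun u : 𝔼 d => ((0 : 𝔼 n), u)) ⁻¹' h.target) :=
    h.open_target.preimage (by fun_prop)
  have hxT : P x ∈ (fun u : 𝔼 d => ((0 : 𝔼 n), u)) ⁻¹' h.target := by
    have := h.map_source hxh
    rwa [hhΦ, hM0 x x.2 hxU] at this
  obtain ⟨r, hr, hball⟩ := Metric.isOpen_iff.1 hT _ hxT
  -- Rescaling a ball to all of `ℝ^d` makes the parametrization total, so later derivatives and
  -- integrals need no domain.
  let β := OpenPartialHomeomorph.univBall (P x) r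
  have hβ : ∀ u, β u ∈ ball (P x) r := fun u => by
    have := β.map_source (x := u) (by simp [β])
    rwa [OpenPartialHomeomorph.univBall_target _ hr] at this
  let φ : 𝔼 d → 𝔼 (n + d) := fun u => h.symm (0, β u)
  have hφs : ∀ u, φ u ∈ h.source := fun u => h.map_target (hball (hβ u))
  have hΦφ : ∀ u, (F (φ u), P (φ u)) = (0, β u) := fun u => by
    rw [← hhΦ]; exact h.right_inv (hball (hβ u))
  have hφM : ∀ u, φ u ∈ M := fun u => hM1 _ (hhU (hφs u)) (congrArg Prod.fst (hΦφ u))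
  have hPφ : ∀ u, P (φ u) = β u := fun u => congrArg Prod.snd (hΦφ u)
  have hrange : range (fun u => (⟨φ u, hφM u⟩ : M)) =
      {y : M | (y : 𝔼 (n + d)) ∈ h.source ∩ P ⁻¹' ball (P x) r} := by
    ext y
    constructor
    · rintro ⟨u, rfl⟩
      exact ⟨hφs u, by simpa only [mem_preimage, hPφ] using hβ u⟩
    · rintro ⟨hy1, hy2⟩
      refine ⟨β.symm (P y), Subtype.ext ?_⟩
      have : β (β.symm (P y)) = P y := β.right_inv (by
        rwa [OpenPartialHomeomorph.univBall_target _ hr])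
      change h.symm (0, β (β.symm (P y))) = y
      rw [this, ← hM0 y y.2 (hhU hy1), ← hhΦ, h.left_inv hy1]
  refine ⟨⟨fun u => ⟨φ u, hφM u⟩, fun y => β.symm (P y), ?_, ?_, ?_, ?_⟩, ?_⟩
  · refine contDiff_iff_contDiffAt.2 fun u => ?_
    change ContDiffAt ℝ ∞ φ u
    exact (hsymm _ (hball (hβ u))).comp u (contDiff_const.prodMk
      OpenPartialHomeomorph.contDiff_univBall).contDiffAt
  · intro u
    change β.symm (P (φ u)) = u
    rw [hPφ]
    exact β.left_inv (by simp [β])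
  · rw [hrange]
    exact (h.open_source.inter (isOpen_ball.preimage P.continuous)).preimage continuous_subtype_val
  · intro u
    refine ContDiffAt.comp _ (OpenPartialHomeomorph.contDiffOn_univBall_symm.contDiffAt
      (isOpen_ball.mem_nhds ?_)) P.contDiff.contDiffAt
    change P (φ u) ∈ _
    rw [hPφ]
    exact hβ u
  · rw [hrange]
    exact ⟨hxh, by simpa using hr⟩

namespace Chart

variable {N d : ℕ} {M : Set (𝔼 N)} (c : Chart d M)

/-- The parametrization of a chart, as a map to the ambient space. -/
def ambient (u : 𝔼 d) : 𝔼 N := c.param u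

theorem contDiff_ambient : ContDiff ℝ ∞ c.ambient := c.contDiff_param

theorem continuous_param : Continuous c.param :=
  c.contDiff_param.continuous.subtype_mk fun u => (c.param u).2

theorem param_injective : Function.Injective c.param := fun u v h => by
  rw [← c.coord_param u, h, c.coord_param]

theorem param_coord {x : M} (hx : x ∈ range c.param) : c.param (c.coord x) = x := by
  obtain ⟨u, rfl⟩ := hx
  rw [c.coord_param]

theorem isOpenEmbedding_param : IsOpenEmbedding c.param := by
  refine IsOpenEmbedding.of_continuous_injective_isOpenMap c.continuous_param c.param_injective ?_
  intro V hV
  have hcont : ContinuousOn (fun x : M => c.coord x) (range c.param) := by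
    rintro _ ⟨u, rfl⟩
    exact ((c.contDiffAt_coord u).continuousAt.comp (x := c.param u)
      continuous_subtype_val.continuousAt).continuousWithinAt
  have : c.param '' V = range c.param ∩ (fun x : M => c.coord x) ⁻¹' V := by
    ext x
    constructor
    · rintro ⟨u, hu, rfl⟩
      exact ⟨⟨u, rfl⟩, by simpa [c.coord_param] using hu⟩
    · rintro ⟨hx, hx'⟩
      exact ⟨_, hx', c.param_coord hx⟩
  rw [this]
  exact hcont.isOpen_inter_preimage c.isOpen_range hV

theorem contDiff_comp_param {f : M → ℝ} (hf : IsSmoothFunction f) :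
    ContDiff ℝ ∞ (fun u => f (c.param u)) :=
  hf d c.param c.contDiff_param

/-- A function on `M` agrees near `c.param u` with its extension to the ambient space by the
coordinates of the chart. -/
theorem eventually_extension (f : M → ℝ) (u : 𝔼 d) :
    ∀ᶠ y : M in 𝓝 (c.param u), f (c.param (c.coord y)) = f y := by
  filter_upwards [c.isOpen_range.mem_nhds ⟨u, rfl⟩] with y hy
  rw [c.param_coord hy]

theorem contDiffAt_extension {f : M → ℝ} (hf : ContDiff ℝ ∞ (fun u => f (c.param u))) (u : 𝔼 d) :
    ContDiffAt ℝ ∞ (fun y => f (c.param (c.coord y))) (c.param u : 𝔼 N) :=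
  ContDiffAt.comp (g := fun v => f (c.param v)) _ hf.contDiffAt (c.contDiffAt_coord u)

end Chart

/-! ### Smoothness on `M` through charts and local extensions -/

/-- Every point of `M` lies in the image of a `d`-dimensional chart. -/
def HasCharts {N : ℕ} (d : ℕ) (M : Set (𝔼 N)) : Prop :=
  ∀ x : M, ∃ c : Chart d M, x ∈ range c.param

section

variable {N d : ℕ} {M : Set (𝔼 N)}

/-- A test map into `M` is continuous, so it stays near `x` and the chain rule applies to `F`.
Parametrizations are themselves test maps, so smoothness can be checked in charts. -/
theorem isSmoothFunction_of_eventuallyEq {f : M → ℝ}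
    (h : ∀ x : M, ∃ F : 𝔼 N → ℝ, ContDiffAt ℝ ∞ F x ∧ ∀ᶠ y : M in 𝓝 x, F y = f y) :
    IsSmoothFunction f := by
  intro m i hi
  refine contDiff_iff_contDiffAt.2 fun u => ?_
  obtain ⟨F, hF, hFf⟩ := h (i u)
  have hi' : Continuous i := hi.continuous.subtype_mk fun u => (i u).2
  refine ((hF.comp u hi.contDiffAt)).congr_of_eventuallyEq ?_
  filter_upwards [hi'.continuousAt.eventually hFf] with v hv
  exact hv.symm

theorem isSmoothFunction_of_contDiff {F : 𝔼 N → ℝ} (hF : ContDiff ℝ ∞ F) :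
    IsSmoothFunction (fun x : M => F x) :=
  isSmoothFunction_of_eventuallyEq fun _ => ⟨F, hF.contDiffAt, .of_forall fun _ => rfl⟩

theorem HasCharts.isSmoothFunction (hM : HasCharts d M) {f : M → ℝ}
    (hf : ∀ c : Chart d M, ContDiff ℝ ∞ (fun u => f (c.param u))) : IsSmoothFunction f := by
  refine isSmoothFunction_of_eventuallyEq fun x => ?_
  obtain ⟨c, u, rfl⟩ := hM x
  exact ⟨_, c.contDiffAt_extension (hf c) u, c.eventually_extension f u⟩

theorem HasCharts.exists_extension (hM : HasCharts d M) {f : M → ℝ} (hf : IsSmoothFunction f)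
    (x : M) : ∃ F : 𝔼 N → ℝ, ContDiffAt ℝ ∞ F x ∧ ∀ᶠ y : M in 𝓝 x, F y = f y := by
  obtain ⟨c, u, rfl⟩ := hM x
  exact ⟨_, c.contDiffAt_extension (c.contDiff_comp_param hf) u, c.eventually_extension f u⟩

theorem HasCharts.continuous (hM : HasCharts d M) {f : M → ℝ} (hf : IsSmoothFunction f) :
    Continuous f := by
  refine continuous_iff_continuousAt.2 fun x => ?_
  obtain ⟨F, hF, hFf⟩ := hM.exists_extension hf x
  exact (hF.continuousAt.comp (x := x) continuous_subtype_val.continuousAt).congr hFf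

end

/-! ### Gradients in coordinates -/

namespace Chart

variable {N d : ℕ} {M : Set (𝔼 N)} (c : Chart d M)

/-- The differential of the parametrization. -/
def differential (u : 𝔼 d) : 𝔼 d →L[ℝ] 𝔼 N := fderiv ℝ c.ambient u

theorem contDiff_differential : ContDiff ℝ ∞ c.differential :=
  c.contDiff_ambient.fderiv_right (by simp)

theorem hasFDerivAt_ambient (u : 𝔼 d) : HasFDerivAt c.ambient (c.differential u) u :=
  (c.contDiff_ambient.differentiable (by simp) u).hasFDerivAt

theorem differential_injective (u : 𝔼 d) : Function.Injective (c.differential u) := by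
  have h1 : HasFDerivAt (fun v => c.coord (c.ambient v))
      ((fderiv ℝ c.coord (c.param u)) ∘L c.differential u) u :=
    ((c.contDiffAt_coord u).differentiableAt (by simp)).hasFDerivAt.comp u (c.hasFDerivAt_ambient u)
  have h2 : HasFDerivAt (fun v => c.coord (c.ambient v)) (ContinuousLinearMap.id ℝ (𝔼 d)) u := by
    have : (fun v => c.coord (c.ambient v)) = id := funext c.coord_param
    rw [this]; exact hasFDerivAt_id u
  have h3 := h1.unique h2
  intro a b hab
  have := congrArg (fderiv ℝ c.coord (c.param u)) hab
  simpa using (DFunLike.congr_fun h3 a).symm.trans (this.trans (DFunLike.congr_fun h3 b))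

/-- The first fundamental form of the parametrization. -/
def metricOperator (u : 𝔼 d) : 𝔼 d →L[ℝ] 𝔼 d :=
  (ContinuousLinearMap.adjoint (c.differential u)) ∘L c.differential u

theorem contDiff_metricOperator : ContDiff ℝ ∞ c.metricOperator :=
  ((ContinuousLinearMap.adjoint (𝕜 := ℝ) (E := 𝔼 d) (F := 𝔼 N)).toContinuousLinearEquiv.contDiff.comp
    c.contDiff_differential).clm_comp c.contDiff_differential

theorem metricOperator_injective (u : 𝔼 d) : Function.Injective (c.metricOperator u) := by
  rw [injective_iff_map_eq_zero]
  intro a ha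
  have : inner ℝ (c.metricOperator u a) a = 0 := by rw [ha, inner_zero_left]
  rw [metricOperator, ContinuousLinearMap.comp_apply, ContinuousLinearMap.adjoint_inner_left,
    inner_self_eq_zero] at this
  exact c.differential_injective u (by simpa using this)

theorem isInvertible_metricOperator (u : 𝔼 d) : (c.metricOperator u).IsInvertible :=
  ⟨(LinearEquiv.ofInjectiveEndo (c.metricOperator u : 𝔼 d →ₗ[ℝ] 𝔼 d)
    (c.metricOperator_injective u)).toContinuousLinearEquiv, by ext; rfl⟩

/-- The coordinates of the gradient of `f`. -/
def gradientCoord (f : M → ℝ) (u : 𝔼 d) : 𝔼 d :=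
  (c.metricOperator u).inverse (gradient (fun v => f (c.param v)) u)

theorem contDiff_gradientCoord {f : M → ℝ} (hf : IsSmoothFunction f) :
    ContDiff ℝ ∞ (c.gradientCoord f) := by
  have h1 : ContDiff ℝ ∞ (fun u => (c.metricOperator u).inverse) :=
    contDiff_iff_contDiffAt.2 fun u =>
      (c.isInvertible_metricOperator u).contDiffAt_map_inverse.comp u
        c.contDiff_metricOperator.contDiffAt
  have h2 : ContDiff ℝ ∞ (fun u => gradient (fun v => f (c.param v)) u) :=
    (InnerProductSpace.toDual ℝ (𝔼 d)).symm.toContinuousLinearEquiv.contDiff.comp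
      ((c.contDiff_comp_param hf).fderiv_right (by simp))
  exact h1.clm_apply h2

/-- With `G` the first fundamental form, `G⁻¹ ∇(f ∘ φ)` is the vector representing `df` in the
metric. The default value of `inverse` never occurs, since `G` is invertible. -/
theorem inner_differential_gradientCoord (f : M → ℝ) (u ξ : 𝔼 d) :
    inner ℝ (c.differential u (c.gradientCoord f u)) (c.differential u ξ) =
      fderiv ℝ (fun v => f (c.param v)) u ξ := by
  rw [← ContinuousLinearMap.adjoint_inner_left]
  have h1 : (ContinuousLinearMap.adjoint (c.differential u)) (c.differential u (c.gradientCoord f u))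
      = gradient (fun v => f (c.param v)) u :=
    DFunLike.congr_fun (c.isInvertible_metricOperator u).self_comp_inverse _
  rw [h1, gradient, InnerProductSpace.toDual_symm_apply]

theorem hasDerivAt_curve {u : 𝔼 d} {γ : ℝ → M} (hγ : IsSmoothCurveAt (c.param u) γ) :
    HasDerivAt (fun t => c.coord (γ t)) (deriv (fun t => c.coord (γ t)) 0) 0 ∧
    velocity γ = c.differential u (deriv (fun t => c.coord (γ t)) 0) ∧
    ∀ᶠ t in 𝓝 (0 : ℝ), c.param (c.coord (γ t)) = γ t := by
  obtain ⟨h1, h2⟩ := hγ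
  have hcont : Continuous γ := h1.continuous.subtype_mk fun t => (γ t).2
  have hev : ∀ᶠ t in 𝓝 (0 : ℝ), c.param (c.coord (γ t)) = γ t := by
    filter_upwards [(c.isOpen_range.preimage hcont).mem_nhds (x := (0 : ℝ))
      (by simp [h2])] with t ht
    exact c.param_coord ht
  have hd : DifferentiableAt ℝ (fun t => c.coord (γ t)) 0 := by
    refine DifferentiableAt.comp (0 : ℝ) (g := c.coord) ?_ (h1.differentiable (by simp) 0)
    rw [h2]
    exact (c.contDiffAt_coord u).differentiableAt (by simp)
  refine ⟨hd.hasDerivAt, ?_, hev⟩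
  have hu : c.coord (γ 0) = u := by rw [h2, c.coord_param]
  have h3 : HasDerivAt (fun t => c.ambient (c.coord (γ t)))
      (c.differential u (deriv (fun t => c.coord (γ t)) 0)) 0 :=
    (c.hasFDerivAt_ambient u).comp_hasDerivAt_of_eq (0 : ℝ) hd.hasDerivAt hu.symm
  refine (h3.congr_of_eventuallyEq ?_).deriv
  filter_upwards [hev] with t ht
  exact congrArg Subtype.val ht.symm

theorem differential_mem_tangentVectors (u ξ : 𝔼 d) :
    c.differential u ξ ∈ tangentVectors (c.param u) := by
  have hl : HasDerivAt (fun t : ℝ => u + t • ξ) ξ 0 := by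
    simpa using ((hasDerivAt_id (0 : ℝ)).smul_const ξ).const_add u
  refine ⟨fun t => c.param (u + t • ξ), ⟨?_, by simp⟩, ?_⟩
  · exact c.contDiff_param.comp (contDiff_const.add (contDiff_id.smul contDiff_const))
  · have h0 : u + (0 : ℝ) • ξ = u := by simp
    exact ((c.hasFDerivAt_ambient u).comp_hasDerivAt_of_eq (0 : ℝ) hl h0.symm).deriv

theorem isGradientAt_param {f : M → ℝ} (hf : IsSmoothFunction f) (u : 𝔼 d) :
    IsGradientAt f (c.param u) (c.differential u (c.gradientCoord f u)) := by
  refine ⟨c.differential_mem_tangentVectors u _, fun γ hγ => ?_⟩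
  obtain ⟨h1, h2, h3⟩ := c.hasDerivAt_curve hγ
  rw [h2, c.inner_differential_gradientCoord]
  have hu : c.coord (γ 0) = u := by rw [hγ.2, c.coord_param]
  have h4 := ((c.contDiff_comp_param hf).differentiable (by simp) u).hasFDerivAt
  refine ((h4.comp_hasDerivAt_of_eq (0 : ℝ) h1 hu.symm).congr_of_eventuallyEq ?_).deriv
  filter_upwards [h3] with t ht
  simp [ht]

end Chart

section

variable {N d : ℕ} {M : Set (𝔼 N)}

/-- The difference `v - w` is orthogonal to `v` and to `w` separately, so no linear structure on the
set of tangent vectors is needed. -/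
theorem IsGradientAt.unique {f : M → ℝ} {x : M} {v w : 𝔼 N} (hv : IsGradientAt f x v)
    (hw : IsGradientAt f x w) : v = w := by
  have key : ∀ z ∈ tangentVectors x, inner ℝ (v - w) z = 0 := by
    rintro _ ⟨γ, hγ, rfl⟩
    rw [inner_sub_left, ← hv.2 γ hγ, ← hw.2 γ hγ, sub_self]
  rw [← sub_eq_zero, ← inner_self_eq_zero (𝕜 := ℝ), inner_sub_right, key v hv.1, key w hw.1,
    sub_self]

theorem IsGradientAt.manifoldGradient_eq {f : M → ℝ} {x : M} {v : 𝔼 N} (hv : IsGradientAt f x v) :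
    manifoldGradient f x = v := by
  have h : ∃ v, IsGradientAt f x v := ⟨v, hv⟩
  rw [manifoldGradient, dif_pos h]
  exact h.choose_spec.unique hv

theorem HasCharts.isGradientAt (hM : HasCharts d M) {f : M → ℝ} (hf : IsSmoothFunction f) (x : M) :
    IsGradientAt f x (manifoldGradient f x) := by
  obtain ⟨c, u, rfl⟩ := hM x
  have := c.isGradientAt_param hf u
  rwa [this.manifoldGradient_eq]

/-- The inner product of the gradients of two functions. -/
def gradientInner (f g : M → ℝ) (x : M) : ℝ :=
  inner ℝ (manifoldGradient f x) (manifoldGradient g x)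

theorem gradientInner_comm (f g : M → ℝ) (x : M) : gradientInner f g x = gradientInner g f x :=
  real_inner_comm _ _

/-- The asymmetric form, a derivative of `f` along the coordinates of `∇g`, makes smoothness,
linearity and the product rule immediate. -/
theorem Chart.gradientInner_param (c : Chart d M) {f g : M → ℝ} (hf : IsSmoothFunction f)
    (hg : IsSmoothFunction g) (u : 𝔼 d) :
    gradientInner f g (c.param u) =
      fderiv ℝ (fun v => f (c.param v)) u (c.gradientCoord g u) := by
  rw [gradientInner, (c.isGradientAt_param hf u).manifoldGradient_eq,
    (c.isGradientAt_param hg u).manifoldGradient_eq, c.inner_differential_gradientCoord]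

theorem HasCharts.isSmoothFunction_gradientInner (hM : HasCharts d M) {f g : M → ℝ}
    (hf : IsSmoothFunction f) (hg : IsSmoothFunction g) :
    IsSmoothFunction (gradientInner f g) := by
  refine hM.isSmoothFunction fun c => ?_
  simp only [c.gradientInner_param hf hg]
  exact ((c.contDiff_comp_param hf).fderiv_right (by simp)).clm_apply (c.contDiff_gradientCoord hg)

theorem HasCharts.gradientInner_mul_left (hM : HasCharts d M) {f g h : M → ℝ}
    (hf : IsSmoothFunction f) (hg : IsSmoothFunction g) (hh : IsSmoothFunction h) (x : M) :
    gradientInner (f * g) h x = f x * gradientInner g h x + g x * gradientInner f h x := by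
  obtain ⟨c, u, rfl⟩ := hM x
  have hfg : IsSmoothFunction (f * g) := (SmoothFunctions M).mul_mem hf hg
  rw [c.gradientInner_param hfg hh, c.gradientInner_param hg hh, c.gradientInner_param hf hh]
  have h1 := (c.contDiff_comp_param hf).differentiable (by simp) u
  have h2 := (c.contDiff_comp_param hg).differentiable (by simp) u
  have : fderiv ℝ (fun v => (f * g) (c.param v)) u = _ := fderiv_fun_mul h1 h2
  rw [this]
  simp

end

/-! ### The volume measure in charts -/

/-- The hypothesis forces `f x = f y` whenever `g x = g y`, so `f` factors through `g` on `s` by a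
`K`-Lipschitz map. -/
theorem euclideanHausdorffMeasure_image_le_of_edist_le {X Y Z : Type*} [EMetricSpace Y]
    [MeasurableSpace Y] [BorelSpace Y] [EMetricSpace Z] [MeasurableSpace Z] [BorelSpace Z]
    (d : ℕ) {f : X → Y} {g : X → Z} {s : Set X} {K : NNReal}
    (h : ∀ x ∈ s, ∀ y ∈ s, edist (f x) (f y) ≤ K * edist (g x) (g y)) :
    μHE[d] (f '' s) ≤ (K : ENNReal) ^ d * μHE[d] (g '' s) := by
  classical
  rcases s.eq_empty_or_nonempty with rfl | ⟨x₀, -⟩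
  · simp
  have : Nonempty X := ⟨x₀⟩
  let k : Z → Y := fun z => f (Function.invFunOn g s z)
  have hk : ∀ x ∈ s, k (g x) = f x := fun x hx => by
    have hx' : ∃ y ∈ s, g y = g x := ⟨x, hx, rfl⟩
    have h1 := h _ (Function.invFunOn_mem hx') x hx
    rw [Function.invFunOn_eq hx', edist_self, mul_zero] at h1
    exact edist_le_zero.1 h1
  have hlip : LipschitzOnWith K k (g '' s) := by
    rintro _ ⟨x, hx, rfl⟩ _ ⟨y, hy, rfl⟩
    rw [hk x hx, hk y hy]
    exact h x hx y hy
  have himg : k '' (g '' s) = f '' s := by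
    rw [image_image]
    exact image_congr hk
  have := hlip.hausdorffMeasure_image_le (d := d) (by positivity)
  rw [himg, ENNReal.rpow_natCast] at this
  simp only [Measure.euclideanHausdorffMeasure_def, Measure.smul_apply, ENNReal.smul_def,
    smul_eq_mul]
  calc _ ≤ _ := mul_le_mul_right this _
    _ = _ := by ring

theorem measure_le_of_locally_le {X : Type*} [TopologicalSpace X] [SecondCountableTopology X]
    [MeasurableSpace X] [BorelSpace X] {μ ν : Measure X}
    (h : ∀ x, ∃ V ∈ 𝓝 x, ∀ A ⊆ V, MeasurableSet A → μ A ≤ ν A) : μ ≤ ν := by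
  choose V hV hle using h
  obtain ⟨s, hs, hcov⟩ := TopologicalSpace.countable_cover_nhds
    (fun x => isOpen_interior.mem_nhds (mem_interior_iff_mem_nhds.2 (hV x)))
  refine Measure.le_iff.2 fun A hA => ?_
  rcases s.eq_empty_or_nonempty with rfl | hne
  · have : A = ∅ := by
      refine eq_empty_of_subset_empty ((subset_univ A).trans ?_)
      rw [← hcov]; simp
    simp [this]
  obtain ⟨f, rfl⟩ := hs.exists_eq_range hne
  rw [biUnion_range, ← iUnion_disjointed] at hcov
  set D := disjointed fun n => interior (V (f n)) with hD
  have hDm : ∀ n, MeasurableSet (D n) := MeasurableSet.disjointed fun n => measurableSet_interior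
  have hsum : ∀ ρ : Measure X, ρ A = ∑' n, ρ (A ∩ D n) := fun ρ => by
    rw [← measure_iUnion, ← inter_iUnion, hcov, inter_univ]
    · exact fun i j hij => ((disjoint_disjointed _) hij).mono inter_subset_right inter_subset_right
    · exact fun n => hA.inter (hDm n)
  rw [hsum μ, hsum ν]
  exact ENNReal.tsum_le_tsum fun n => hle (f n) _
    (inter_subset_right.trans ((disjointed_subset _ n).trans interior_subset)) (hA.inter (hDm n))

/-- For each fixed `K` a countable disjoint decomposition makes the comparison global; only then
does `K` tend to 1, so `V` may depend on `K`. -/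
theorem measure_eq_of_locally_comparable {X : Type*} [TopologicalSpace X]
    [SecondCountableTopology X] [MeasurableSpace X] [BorelSpace X] {μ ν : Measure X} (k : ℕ)
    (h : ∀ K : NNReal, 1 < K → ∀ x, ∃ V ∈ 𝓝 x, ∀ A ⊆ V, MeasurableSet A →
      μ A ≤ (K : ENNReal) ^ k * ν A ∧ ν A ≤ (K : ENNReal) ^ k * μ A) : μ = ν := by
  have key : ∀ ρ σ : Measure X, (∀ K : NNReal, 1 < K → ρ ≤ (K : ENNReal) ^ k • σ) → ρ ≤ σ := by
    intro ρ σ H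
    refine Measure.le_iff.2 fun A hA => ?_
    have hlim : Tendsto (fun K : NNReal => (K : ENNReal) ^ k * σ A) (𝓝[>] 1) (𝓝 (1 * σ A)) := by
      refine ENNReal.Tendsto.mul_const ?_ (Or.inl one_ne_zero)
      have : Continuous fun K : NNReal => (K : ENNReal) ^ k :=
        (ENNReal.continuous_pow k).comp ENNReal.continuous_coe
      simpa [ContinuousWithinAt] using this.continuousWithinAt (s := Ioi 1) (x := 1)
    rw [one_mul] at hlim
    refine ge_of_tendsto hlim ?_
    filter_upwards [self_mem_nhdsWithin] with K hK
    simpa using Measure.le_iff.1 (H K hK) A hA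
  refine le_antisymm (key _ _ fun K hK => ?_) (key _ _ fun K hK => ?_)
  · refine measure_le_of_locally_le fun x => ?_
    obtain ⟨V, hV, hle⟩ := h K hK x
    exact ⟨V, hV, fun A hAV hA => by simpa using (hle A hAV hA).1⟩
  · refine measure_le_of_locally_le fun x => ?_
    obtain ⟨V, hV, hle⟩ := h K hK x
    exact ⟨V, hV, fun A hAV hA => by simpa using (hle A hAV hA).2⟩

namespace Chart

variable {N d : ℕ} {M : Set (𝔼 N)} (c : Chart d M)

/-- The differential at `u₀` is bounded below, so by continuity nearby differentials differ from it
by a small relative error `η`, and the mean value inequality transfers this to the parametrization.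
-/
theorem exists_ball_bilipschitz (u₀ : 𝔼 d) {κ : ℝ} (hκ : 1 < κ) :
    ∃ r > 0, (∀ u ∈ ball u₀ r, ∀ ξ, ‖c.differential u ξ‖ ≤ κ * ‖c.differential u₀ ξ‖) ∧
      ∀ u ∈ ball u₀ r, ∀ v ∈ ball u₀ r,
        ‖c.ambient u - c.ambient v‖ ≤ κ * ‖c.differential u₀ (u - v)‖ ∧
        ‖c.differential u₀ (u - v)‖ ≤ κ * ‖c.ambient u - c.ambient v‖ := by
  obtain ⟨K, hK, hanti⟩ := (c.differential u₀ : 𝔼 d →ₗ[ℝ] 𝔼 N).exists_antilipschitzWith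
    (LinearMap.ker_eq_bot.2 (c.differential_injective u₀))
  have hL : ∀ ξ, ‖ξ‖ ≤ K * ‖c.differential u₀ ξ‖ := fun ξ => by
    simpa using hanti.le_mul_dist ξ 0
  have hκ0 : 0 < κ := by linarith
  -- This choice gives both `1 + η ≤ κ` and `κ (1 - η) = 1`, one for each direction of the
  -- comparison.
  set η : ℝ := (κ - 1) / κ with hη
  have hη0 : 0 < η := div_pos (by linarith) hκ0
  have hη1 : 1 + η ≤ κ := by
    have : η ≤ κ - 1 := div_le_self (by linarith) hκ.le
    linarith
  have hη2 : κ * (1 - η) = 1 := by rw [hη]; field_simp; ring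
  obtain ⟨r, hr, hball⟩ := Metric.continuousAt_iff.1
    (c.contDiff_differential.continuous.continuousAt (x := u₀)) (η / K) (by positivity)
  have hop : ∀ u ∈ ball u₀ r, ‖c.differential u - c.differential u₀‖ ≤ η / K := fun u hu => by
    rw [← dist_eq_norm]; exact (hball hu).le
  have hmul : ∀ ξ, η / K * ‖ξ‖ ≤ η * ‖c.differential u₀ ξ‖ := fun ξ => by
    calc η / K * ‖ξ‖ ≤ η / K * (K * ‖c.differential u₀ ξ‖) := by gcongr; exact hL ξ
      _ = _ := by field_simp
  refine ⟨r, hr, fun u hu ξ => ?_, fun u hu v hv => ?_⟩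
  · have h1 : ‖c.differential u ξ - c.differential u₀ ξ‖ ≤ η * ‖c.differential u₀ ξ‖ :=
      ((c.differential u - c.differential u₀).le_of_opNorm_le (hop u hu) ξ).trans (hmul ξ)
    have h2 := norm_le_norm_add_norm_sub' (c.differential u ξ) (c.differential u₀ ξ)
    nlinarith [norm_nonneg (c.differential u₀ ξ)]
  · have h1 : ‖c.ambient u - c.ambient v - c.differential u₀ (u - v)‖
        ≤ η * ‖c.differential u₀ (u - v)‖ :=
      ((convex_ball u₀ r).norm_image_sub_le_of_norm_hasFDerivWithin_le'
        (fun x _ => (c.hasFDerivAt_ambient x).hasFDerivWithinAt) hop hv hu).trans (hmul _)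
    have h2 := norm_le_norm_add_norm_sub' (c.ambient u - c.ambient v) (c.differential u₀ (u - v))
    have h3 := norm_le_norm_add_norm_sub (c.ambient u - c.ambient v) (c.differential u₀ (u - v))
    constructor
    · nlinarith [norm_nonneg (c.differential u₀ (u - v))]
    · have h4 : (1 - η) * ‖c.differential u₀ (u - v)‖ ≤ ‖c.ambient u - c.ambient v‖ := by linarith
      calc ‖c.differential u₀ (u - v)‖ = κ * ((1 - η) * ‖c.differential u₀ (u - v)‖) := by
            rw [← mul_assoc, hη2, one_mul]
        _ ≤ _ := by gcongr

/-- The density of the volume measure of `M` in a chart. -/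
def density (u : 𝔼 d) : ℝ := (c.differential u : 𝔼 d →ₗ[ℝ] 𝔼 N).normDet

theorem density_pos (u : 𝔼 d) : 0 < c.density u := by
  refine lt_of_le_of_ne (LinearMap.normDet_nonneg _) fun h => ?_
  exact LinearMap.normDet_eq_zero_iff_ker_ne_bot.1 h.symm
    (LinearMap.ker_eq_bot.2 (c.differential_injective u))

/-- The squared density is the Gram determinant, polynomial in the entries of the differential's
Gram matrix; positivity makes its square root smooth. -/
theorem contDiff_density : ContDiff ℝ ∞ c.density := by
  have h1 : ∀ u, c.density u ^ 2 =
      (Matrix.gram ℝ fun i => c.differential u (EuclideanSpace.basisFun (Fin d) ℝ i)).det :=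
    fun u => LinearMap.normDet_sq_eq_det_gram (c.differential u : 𝔼 d →ₗ[ℝ] 𝔼 N)
      (EuclideanSpace.basisFun (Fin d) ℝ)
  have h2 : ContDiff ℝ ∞ fun u => c.density u ^ 2 := by
    simp only [h1, Matrix.det_apply', Matrix.gram_apply]
    refine ContDiff.sum fun σ _ => contDiff_const.mul (contDiff_prod fun i _ => ?_)
    exact (c.contDiff_differential.clm_apply contDiff_const).inner ℝ
      (c.contDiff_differential.clm_apply contDiff_const)
  have h3 : c.density = fun u => √(c.density u ^ 2) := by
    ext u; rw [Real.sqrt_sq (c.density_pos u).le]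
  rw [h3]
  exact h2.sqrt fun u => (pow_pos (c.density_pos u) 2).ne'

/-- Near `u₀` the parametrization is `K`-bilipschitz to its differential, whose effect on volume is
the constant factor `density u₀`. This costs `K ^ d`, and the variation of the density costs one
more `K`, whence the exponent `d + 1`. -/
theorem comap_param_euclideanHausdorffMeasure :
    (μHE[d] : Measure M).comap c.param =
      (volume : Measure (𝔼 d)).withDensity fun u => ENNReal.ofReal (c.density u) := by
  refine measure_eq_of_locally_comparable (d + 1) fun K hK u₀ => ?_
  have hK' : (1 : ℝ) < K := hK
  obtain ⟨r, hr, -, hbil⟩ := c.exists_ball_bilipschitz u₀ hK'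
  have hJ0 := c.density_pos u₀
  have hJ : ∀ᶠ u in 𝓝 u₀, c.density u < K * c.density u₀ ∧ c.density u₀ < K * c.density u := by
    have hc := c.contDiff_density.continuous
    refine (hc.continuousAt.eventually_lt continuousAt_const ?_).and
      (continuousAt_const.eventually_lt (continuous_const.mul hc).continuousAt ?_) <;> nlinarith
  refine ⟨_, inter_mem (ball_mem_nhds u₀ hr) hJ, fun A hA hAm => ?_⟩
  have hAb : A ⊆ ball u₀ r := hA.trans inter_subset_left
  rw [c.isOpenEmbedding_param.measurableEmbedding.comap_apply,
    ← isometry_subtype_coe.euclideanHausdorffMeasure_image, image_image, withDensity_apply _ hAm]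
  change μHE[d] (c.ambient '' A) ≤ _ ∧ _ ≤ _ * μHE[d] (c.ambient '' A)
  have hlin : μHE[d] (c.differential u₀ '' A) = ENNReal.ofReal (c.density u₀) * volume A := by
    have := LinearMap.euclideanHausdorffMeasure_image_eq_normDet_mul_volume
      (c.differential u₀ : 𝔼 d →ₗ[ℝ] 𝔼 N) A
    rwa [finrank_euclideanSpace, Fintype.card_fin] at this
  have hofK : ENNReal.ofReal K = K := ENNReal.ofReal_coe_nnreal
  have hJ1 : ENNReal.ofReal (c.density u₀) * volume A
      ≤ K * ∫⁻ u in A, ENNReal.ofReal (c.density u) := by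
    rw [← lintegral_const_mul' _ _ ENNReal.coe_ne_top, ← setLIntegral_const]
    refine setLIntegral_mono' hAm fun u hu => ?_
    rw [← hofK, ← ENNReal.ofReal_mul (by positivity)]
    exact ENNReal.ofReal_le_ofReal (hA hu).2.2.le
  have hJ2 : ∫⁻ u in A, ENNReal.ofReal (c.density u)
      ≤ K * (ENNReal.ofReal (c.density u₀) * volume A) := by
    rw [← mul_assoc, ← setLIntegral_const]
    refine setLIntegral_mono' hAm fun u hu => ?_
    rw [← hofK, ← ENNReal.ofReal_mul (by positivity)]
    exact ENNReal.ofReal_le_ofReal (hA hu).2.1.le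
  have hedist : ∀ {x y z w : 𝔼 N}, ‖x - y‖ ≤ K * ‖z - w‖ → edist x y ≤ K * edist z w := by
    intro x y z w h
    rw [edist_dist, edist_dist, dist_eq_norm, dist_eq_norm, ← hofK, ← ENNReal.ofReal_mul (by positivity)]
    exact ENNReal.ofReal_le_ofReal h
  have hH1 : μHE[d] (c.ambient '' A) ≤ (K : ENNReal) ^ d * μHE[d] (c.differential u₀ '' A) :=
    euclideanHausdorffMeasure_image_le_of_edist_le d fun x hx y hy => hedist (by
      rw [← map_sub]; exact (hbil x (hAb hx) y (hAb hy)).1)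
  have hH2 : μHE[d] (c.differential u₀ '' A) ≤ (K : ENNReal) ^ d * μHE[d] (c.ambient '' A) :=
    euclideanHausdorffMeasure_image_le_of_edist_le d fun x hx y hy => hedist (by
      rw [← map_sub]; exact (hbil x (hAb hx) y (hAb hy)).2)
  rw [hlin] at hH1 hH2
  constructor
  · calc _ ≤ _ := hH1
      _ ≤ (K : ENNReal) ^ d * (K * ∫⁻ u in A, ENNReal.ofReal (c.density u)) := by gcongr
      _ = _ := by ring
  · calc _ ≤ _ := hJ2
      _ ≤ K * ((K : ENNReal) ^ d * μHE[d] (c.ambient '' A)) := by gcongr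
      _ = _ := by ring

theorem setIntegral_range_param (f : M → ℝ) :
    ∫ x in range c.param, f x ∂(μHE[d] : Measure M) = ∫ u, c.density u * f (c.param u) := by
  have hemb := c.isOpenEmbedding_param.measurableEmbedding
  rw [← hemb.map_comap, hemb.integral_map, c.comap_param_euclideanHausdorffMeasure,
    integral_withDensity_eq_integral_toReal_smul]
  · simp [ENNReal.toReal_ofReal (c.density_pos _).le]
  · exact c.contDiff_density.continuous.measurable.ennreal_ofReal
  · simp

end Chart

section

variable {N d : ℕ} {M : Set (𝔼 N)}

theorem HasCharts.isLocallyFiniteMeasure (hM : HasCharts d M) :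
    IsLocallyFiniteMeasure (μHE[d] : Measure M) := by
  refine ⟨fun x => ?_⟩
  obtain ⟨c, u, rfl⟩ := hM x
  refine ⟨c.param '' ball u 1, c.isOpenEmbedding_param.isOpenMap.image_mem_nhds
    (ball_mem_nhds u one_pos), ?_⟩
  have hemb := c.isOpenEmbedding_param.measurableEmbedding
  rw [← hemb.comap_apply, c.comap_param_euclideanHausdorffMeasure,
    withDensity_apply _ measurableSet_ball]
  obtain ⟨C, hC⟩ := (isCompact_closedBall u 1).exists_bound_of_continuousOn
    c.contDiff_density.continuous.continuousOn
  calc _ ≤ ∫⁻ _ in ball u 1, ENNReal.ofReal C := setLIntegral_mono' measurableSet_ball fun v hv =>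
        ENNReal.ofReal_le_ofReal ((le_abs_self _).trans (hC v (ball_subset_closedBall hv)))
    _ < ⊤ := by
      rw [setLIntegral_const]
      exact ENNReal.mul_lt_top ENNReal.ofReal_lt_top measure_ball_lt_top

/-- Positivity of the density is what later lets `∫ h² = 0` force a smooth `h` to vanish everywhere.
-/
theorem HasCharts.isOpenPosMeasure (hM : HasCharts d M) :
    (μHE[d] : Measure M).IsOpenPosMeasure := by
  refine ⟨fun U hU ⟨x, hx⟩ h0 => ?_⟩
  obtain ⟨c, u, rfl⟩ := hM x
  have hemb := c.isOpenEmbedding_param.measurableEmbedding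
  have hV := hU.preimage c.continuous_param
  have h1 : (μHE[d] : Measure M).comap c.param (c.param ⁻¹' U) = 0 := by
    rw [hemb.comap_apply]
    exact measure_mono_null (image_preimage_subset _ _) h0
  rw [c.comap_param_euclideanHausdorffMeasure, withDensity_apply_eq_zero
    c.contDiff_density.continuous.measurable.ennreal_ofReal] at h1
  have h2 : {v | ENNReal.ofReal (c.density v) ≠ 0} = univ :=
    eq_univ_of_forall fun v => by simpa using c.density_pos v
  rw [h2, univ_inter] at h1
  exact (hV.measure_pos volume ⟨u, hx⟩).ne' h1

end

/-! ### Integration by parts and the Laplace–Beltrami operator -/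

open scoped Manifold in
theorem exists_finite_smooth_partition {N : ℕ} {K : Set (𝔼 N)} (hK : IsCompact K)
    (W : K → Set (𝔼 N)) (hW : ∀ x, IsOpen (W x)) (hxW : ∀ x : K, (x : 𝔼 N) ∈ W x) :
    ∃ (s : Finset K) (χ : s → 𝔼 N → ℝ), (∀ i, ContDiff ℝ ∞ (χ i)) ∧ (∀ i x, 0 ≤ χ i x) ∧
      (∀ i, tsupport (χ i) ⊆ W i) ∧ ∀ x ∈ K, ∑ i, χ i x = 1 := by
  obtain ⟨s, hs⟩ := hK.elim_finite_subcover W hW fun x hx => mem_iUnion.2 ⟨⟨x, hx⟩, hxW ⟨x, hx⟩⟩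
  obtain ⟨χ, hχ⟩ := SmoothPartitionOfUnity.exists_isSubordinate 𝓘(ℝ, 𝔼 N) hK.isClosed
    (fun i : s => W i) (fun i => hW i) (fun x hx => by simpa using hs hx)
  refine ⟨s, fun i => χ i, fun i => (χ i).contMDiff.contDiff, fun i x => χ.nonneg i x,
    fun i => hχ i, fun x hx => ?_⟩
  rw [← finsum_eq_sum_of_fintype]
  exact χ.sum_eq_one hx

/-- **Divergence theorem** for compactly supported vector fields on `ℝ^d`. -/
theorem integral_fderiv_apply_eq_neg_integral_mul_divergence {d : ℕ} {f : 𝔼 d → ℝ}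
    {b : 𝔼 d → 𝔼 d} (hf : ContDiff ℝ ∞ f) (hb : ContDiff ℝ ∞ b) (hbc : HasCompactSupport b) :
    ∫ u, fderiv ℝ f u (b u) =
      -∫ u, f u * ∑ i, fderiv ℝ (fun v => b v i) u (EuclideanSpace.single i 1) := by
  have hbi : ∀ i, ContDiff ℝ ∞ (fun v => b v i) := fun i => by fun_prop
  have hbic : ∀ i, HasCompactSupport (fun v => b v i) := fun i =>
    hbc.comp_left (g := fun w : 𝔼 d => w i) rfl
  have hdf : ∀ i, Continuous fun u => fderiv ℝ f u (EuclideanSpace.single i (1 : ℝ)) := fun i =>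
    (hf.continuous_fderiv (by simp)).clm_apply continuous_const
  have hdb : ∀ i, Continuous fun u =>
      fderiv ℝ (fun v => b v i) u (EuclideanSpace.single i (1 : ℝ)) := fun i =>
    ((hbi i).continuous_fderiv (by simp)).clm_apply continuous_const
  have hdbc : ∀ i, HasCompactSupport fun u =>
      fderiv ℝ (fun v => b v i) u (EuclideanSpace.single i (1 : ℝ)) := fun i =>
    ((hbic i).fderiv ℝ).comp_left (g := fun A : 𝔼 d →L[ℝ] ℝ => A (EuclideanSpace.single i 1)) rfl
  have hint1 : ∀ i, Integrable fun u =>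
      b u i * fderiv ℝ f u (EuclideanSpace.single i (1 : ℝ)) := fun i =>
    ((hbi i).continuous.mul (hdf i)).integrable_of_hasCompactSupport (hbic i).mul_right
  have hint2 : ∀ i, Integrable fun u =>
      fderiv ℝ (fun v => b v i) u (EuclideanSpace.single i (1 : ℝ)) * f u := fun i =>
    ((hdb i).mul hf.continuous).integrable_of_hasCompactSupport (hdbc i).mul_right
  have hint3 : ∀ i, Integrable fun u => b u i * f u := fun i =>
    ((hbi i).continuous.mul hf.continuous).integrable_of_hasCompactSupport (hbic i).mul_right
  have hexp : ∀ u, fderiv ℝ f u (b u) =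
      ∑ i, b u i * fderiv ℝ f u (EuclideanSpace.single i (1 : ℝ)) := fun u => by
    conv_lhs => rw [← (EuclideanSpace.basisFun (Fin d) ℝ).sum_repr (b u)]
    simp
  simp only [hexp, Finset.mul_sum]
  rw [integral_finsetSum _ fun i _ => hint1 i, integral_finsetSum _ fun i _ => by
    simpa only [mul_comm] using hint2 i, ← Finset.sum_neg_distrib]
  refine Finset.sum_congr rfl fun i _ => ?_
  -- Only `b` has compact support; that suffices for the three products to be integrable, with no
  -- decay of `f`.
  rw [integral_mul_fderiv_eq_neg_fderiv_mul_of_integrable (hint2 i) (hint1 i) (hint3 i)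
    (fun x _ => (hbi i).differentiable (by simp) x) (fun x _ => hf.differentiable (by simp) x)]
  simp only [mul_comm]

section

variable {N d : ℕ} {M : Set (𝔼 N)}

theorem Chart.exists_smooth_extension_of_hasCompactSupport (c : Chart d M) {k : 𝔼 d → ℝ}
    (hk : ContDiff ℝ ∞ k) (hkc : HasCompactSupport k) :
    ∃ h : M → ℝ, IsSmoothFunction h ∧ (∀ u, h (c.param u) = k u) ∧
      ∀ x ∉ range c.param, h x = 0 := by
  classical
  let h : M → ℝ := fun x => if x ∈ range c.param then k (c.coord x) else 0
  have hp : ∀ u, h (c.param u) = k u := fun u => by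
    simp [h, c.coord_param]
  have h0 : ∀ x ∉ range c.param, h x = 0 := fun x hx => if_neg hx
  refine ⟨h, isSmoothFunction_of_eventuallyEq fun x => ?_, hp, h0⟩
  by_cases hx : x ∈ range c.param
  · obtain ⟨u, rfl⟩ := hx
    refine ⟨fun y => h (c.param (c.coord y)), c.contDiffAt_extension ?_ u,
      c.eventually_extension h u⟩
    simpa only [hp] using hk
  · refine ⟨fun _ => 0, contDiffAt_const, ?_⟩
    -- The image of the support is compact, hence closed in `M`, so extension by zero is smooth even
    -- at the boundary of the chart.
    have hcl : IsClosed (c.param '' tsupport k) := (hkc.isCompact.image c.continuous_param).isClosed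
    have hx' : x ∉ c.param '' tsupport k := fun ⟨u, _, hu⟩ => hx ⟨u, hu⟩
    filter_upwards [hcl.isOpen_compl.mem_nhds hx'] with y hy
    by_cases hyr : y ∈ range c.param
    · obtain ⟨u, rfl⟩ := hyr
      rw [hp]
      exact (image_eq_zero_of_notMem_tsupport fun hu => hy ⟨u, hu, rfl⟩).symm
    · exact (h0 y hyr).symm

/-- Integration by parts inside one chart. -/
theorem Chart.exists_integral_mul_gradientInner (c : Chart d M) {χ g : M → ℝ}
    (hχ : IsSmoothFunction χ) (hχc : HasCompactSupport fun u => χ (c.param u))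
    (hχ0 : ∀ x ∉ range c.param, χ x = 0) (hg : IsSmoothFunction g) :
    ∃ h : M → ℝ, IsSmoothFunction h ∧ ∀ f : M → ℝ, IsSmoothFunction f →
      ∫ x, f x * h x ∂(μHE[d] : Measure M) =
        -∫ x, χ x * gradientInner f g x ∂(μHE[d] : Measure M) := by
  -- With `ρ` the density, the field is `χ ρ ∇g` in coordinates; its Euclidean divergence divided by
  -- `ρ` is `div(χ ∇g)` on `M`.
  let b : 𝔼 d → 𝔼 d := fun u => (χ (c.param u) * c.density u) • c.gradientCoord g u
  have hb : ContDiff ℝ ∞ b := ((c.contDiff_comp_param hχ).mul c.contDiff_density).smul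
    (c.contDiff_gradientCoord hg)
  have hbc : HasCompactSupport b := hχc.mul_right.smul_right
  have hbi : ∀ i, ContDiff ℝ ∞ (fun v => b v i) := fun i => by fun_prop
  let β : 𝔼 d → ℝ := fun u => ∑ i, fderiv ℝ (fun v => b v i) u (EuclideanSpace.single i 1)
  have hβ : ContDiff ℝ ∞ β := ContDiff.sum fun i _ =>
    ((hbi i).fderiv_right (by simp)).clm_apply contDiff_const
  have hβc : HasCompactSupport β := by
    refine HasCompactSupport.of_support_subset_isCompact hbc.isCompact fun u hu => ?_
    by_contra hu'
    refine hu (Finset.sum_eq_zero fun i _ => ?_)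
    have : (fun v => b v i) =ᶠ[𝓝 u] fun _ => 0 := by
      filter_upwards [(isClosed_tsupport b).isOpen_compl.mem_nhds hu'] with v hv
      rw [image_eq_zero_of_notMem_tsupport hv]; rfl
    rw [this.fderiv_eq]
    simp
  obtain ⟨h, hh, hhp, hh0⟩ := c.exists_smooth_extension_of_hasCompactSupport
    (k := fun u => β u / c.density u) (hβ.div c.contDiff_density fun u => (c.density_pos u).ne')
    (by simp only [div_eq_mul_inv]; exact hβc.mul_right)
  refine ⟨h, hh, fun f hf => ?_⟩
  rw [← setIntegral_eq_integral_of_forall_compl_eq_zero (s := range c.param)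
      (f := fun x => f x * h x) (fun x hx => by rw [hh0 x hx, mul_zero]),
    ← setIntegral_eq_integral_of_forall_compl_eq_zero (s := range c.param)
      (f := fun x => χ x * gradientInner f g x) (fun x hx => by rw [hχ0 x hx, zero_mul]),
    c.setIntegral_range_param, c.setIntegral_range_param]
  have h1 : ∀ u, c.density u * (f (c.param u) * h (c.param u)) = f (c.param u) * β u := fun u => by
    have := (c.density_pos u).ne'
    rw [hhp]; field_simp
  have h2 : ∀ u, c.density u * (χ (c.param u) * gradientInner f g (c.param u)) =
      fderiv ℝ (fun v => f (c.param v)) u (b u) := fun u => by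
    rw [c.gradientInner_param hf hg, map_smul, smul_eq_mul]; ring
  simp only [h1, h2]
  rw [integral_fderiv_apply_eq_neg_integral_mul_divergence (c.contDiff_comp_param hf) hb hbc,
    neg_neg]

theorem HasCharts.integrable (hM : HasCharts d M) (hK : IsCompact M) {f : M → ℝ}
    (hf : IsSmoothFunction f) : Integrable f (μHE[d] : Measure M) := by
  have := isCompact_iff_compactSpace.1 hK
  have := hM.isLocallyFiniteMeasure
  exact (hM.continuous hf).integrable_of_hasCompactSupport (HasCompactSupport.of_compactSpace f)

theorem HasCharts.integrable_mul (hM : HasCharts d M) (hK : IsCompact M) {f g : M → ℝ}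
    (hf : IsSmoothFunction f) (hg : IsSmoothFunction g) :
    Integrable (fun x => f x * g x) (μHE[d] : Measure M) :=
  hM.integrable hK ((SmoothFunctions M).mul_mem hf hg)

theorem HasCharts.eq_zero_of_integral_mul_self (hM : HasCharts d M) (hK : IsCompact M)
    {h : M → ℝ} (hh : IsSmoothFunction h)
    (h0 : ∫ x, h x * h x ∂(μHE[d] : Measure M) = 0) : h = 0 := by
  have := hM.isOpenPosMeasure
  have hhh : IsSmoothFunction (fun x => h x * h x) := (SmoothFunctions M).mul_mem hh hh
  have h1 := (integral_eq_zero_iff_of_nonneg (fun x => mul_self_nonneg (h x))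
    (hM.integrable hK hhh)).1 h0
  have h2 := (hM.continuous hhh).ae_eq_iff_eq _ continuous_zero |>.1 h1
  ext x
  exact mul_self_eq_zero.1 (congrFun h2 x)

/-- Since `∑ χ i = 1` on `M`, summing the chartwise functions `div(χ i ∇g)` gives `div ∇g`. -/
theorem HasCharts.exists_laplacian (hM : HasCharts d M) (hK : IsCompact M) {g : M → ℝ}
    (hg : IsSmoothFunction g) :
    ∃ h : M → ℝ, IsSmoothFunction h ∧ ∀ f : M → ℝ, IsSmoothFunction f →
      ∫ x, f x * h x ∂(μHE[d] : Measure M) = -∫ x, gradientInner f g x ∂(μHE[d] : Measure M) := by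
  have := isCompact_iff_compactSpace.1 hK
  choose c hc using hM
  choose W hW hWr using fun x => isOpen_induced_iff.1 (c x).isOpen_range
  obtain ⟨s, χ, hχ, -, hχW, hχ1⟩ := exists_finite_smooth_partition hK W hW
    (fun x => by have := hc x; rwa [← hWr] at this)
  have hχ0 : ∀ (i : s) (x : M), x ∉ range (c i).param → χ i x = 0 := fun i x hx =>
    image_eq_zero_of_notMem_tsupport fun hx' => hx (by rw [← hWr]; exact hχW i hx')
  have hχc : ∀ i, HasCompactSupport fun u => χ i ((c i).param u) := fun i => by
    refine HasCompactSupport.of_support_subset_isCompact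
      (K := (c i).param ⁻¹' ((↑) ⁻¹' tsupport (χ i))) ?_ fun u hu => subset_tsupport _ hu
    refine (c i).isOpenEmbedding_param.isInducing.isCompact_preimage' ?_ ?_
    · exact ((isClosed_tsupport _).preimage continuous_subtype_val).isCompact
    · rw [← hWr]; exact preimage_mono (hχW i)
  have hχs : ∀ i, IsSmoothFunction (fun x : M => χ i x) := fun i =>
    isSmoothFunction_of_contDiff (hχ i)
  choose h hh hint using fun i : s => (c i).exists_integral_mul_gradientInner (hχs i) (hχc i) (hχ0 i) hg
  have hM' : HasCharts d M := fun x => ⟨c x, hc x⟩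
  refine ⟨∑ i, h i, (SmoothFunctions M).sum_mem fun i _ => hh i, fun f hf => ?_⟩
  have h1 : ∀ x : M, gradientInner f g x = ∑ i, χ i x * gradientInner f g x := fun x => by
    rw [← Finset.sum_mul, hχ1 x x.2, one_mul]
  have hfg := hM'.isSmoothFunction_gradientInner hf hg
  simp only [Finset.sum_apply, Finset.mul_sum]
  rw [integral_finsetSum _ fun i _ => hM'.integrable_mul hK hf (hh i),
    integral_congr_ae (.of_forall h1), integral_finsetSum _ fun i _ =>
      hM'.integrable_mul hK (hχs i) hfg, ← Finset.sum_neg_distrib]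
  exact Finset.sum_congr rfl fun i _ => hint i f hf

theorem HasCharts.gradientInner_add_right (hM : HasCharts d M) {f g h : M → ℝ}
    (hf : IsSmoothFunction f) (hg : IsSmoothFunction g) (hh : IsSmoothFunction h) (x : M) :
    gradientInner f (g + h) x = gradientInner f g x + gradientInner f h x := by
  obtain ⟨c, u, rfl⟩ := hM x
  rw [gradientInner_comm f, gradientInner_comm f, gradientInner_comm f,
    c.gradientInner_param ((SmoothFunctions M).add_mem hg hh) hf, c.gradientInner_param hg hf,
    c.gradientInner_param hh hf]
  have : fderiv ℝ (fun v => (g + h) (c.param v)) u = _ :=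
    fderiv_fun_add ((c.contDiff_comp_param hg).differentiable (by simp) u)
      ((c.contDiff_comp_param hh).differentiable (by simp) u)
  rw [this]
  rfl

theorem HasCharts.gradientInner_smul_right (hM : HasCharts d M) {f g : M → ℝ}
    (hf : IsSmoothFunction f) (hg : IsSmoothFunction g) (a : ℝ) (x : M) :
    gradientInner f (a • g) x = a * gradientInner f g x := by
  obtain ⟨c, u, rfl⟩ := hM x
  rw [gradientInner_comm f, gradientInner_comm f,
    c.gradientInner_param ((SmoothFunctions M).smul_mem hg a) hf, c.gradientInner_param hg hf]
  have : fderiv ℝ (fun v => (a • g) (c.param v)) u = _ :=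
    fderiv_fun_const_smul ((c.contDiff_comp_param hg).differentiable (by simp) u) a
  rw [this]
  rfl

theorem HasCharts.eq_of_integral_mul_eq (hM : HasCharts d M) (hK : IsCompact M)
    {h k : SmoothFunctions M}
    (hhk : ∀ f : SmoothFunctions M, ∫ x, f.1 x * h.1 x ∂(μHE[d] : Measure M) =
      ∫ x, f.1 x * k.1 x ∂(μHE[d] : Measure M)) : h = k := by
  have h1 : (h - k).1 = 0 := by
    refine hM.eq_zero_of_integral_mul_self hK (h - k).2 ?_
    have h2 : ∀ x, (h - k).1 x * (h - k).1 x = (h - k).1 x * h.1 x - (h - k).1 x * k.1 x :=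
      fun x => mul_sub _ _ _
    simp only [h2]
    rw [integral_sub (hM.integrable_mul hK (h - k).2 h.2) (hM.integrable_mul hK (h - k).2 k.2),
      hhk, sub_self]
  exact sub_eq_zero.1 (Subtype.ext h1)

/-- The Laplacians are chosen one `g` at a time; additivity, homogeneity and uniqueness all come
from `HasCharts.eq_of_integral_mul_eq`. -/
theorem HasCharts.existsUnique_isLaplaceBeltrami (hM : HasCharts d M) (hK : IsCompact M) :
    ∃! Δ : SmoothFunctions M →ₗ[ℝ] SmoothFunctions M, IsLaplaceBeltrami d Δ := by
  choose h hh hint using fun g : SmoothFunctions M => hM.exists_laplacian hK g.2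
  let D : SmoothFunctions M → SmoothFunctions M := fun g => ⟨h g, hh g⟩
  have hD : ∀ f g : SmoothFunctions M, ∫ x, f.1 x * (D g).1 x ∂(μHE[d] : Measure M) =
      -∫ x, gradientInner f.1 g.1 x ∂(μHE[d] : Measure M) := fun f g => hint g f.1 f.2
  have hinn : ∀ f g : SmoothFunctions M, Integrable (gradientInner f.1 g.1) (μHE[d] : Measure M) :=
    fun f g => hM.integrable hK (hM.isSmoothFunction_gradientInner f.2 g.2)
  let Δ : SmoothFunctions M →ₗ[ℝ] SmoothFunctions M :=
    { toFun := D
      map_add' := fun g k => hM.eq_of_integral_mul_eq hK fun f => by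
        have h1 : ∀ x, f.1 x * (D g + D k).1 x = f.1 x * (D g).1 x + f.1 x * (D k).1 x :=
          fun x => mul_add _ _ _
        have h2 : ∀ x, gradientInner f.1 (g + k).1 x
            = gradientInner f.1 g.1 x + gradientInner f.1 k.1 x :=
          hM.gradientInner_add_right f.2 g.2 k.2
        rw [hD]
        simp only [h1, h2]
        rw [integral_add (hinn f g) (hinn f k), integral_add (hM.integrable_mul hK f.2 (D g).2)
          (hM.integrable_mul hK f.2 (D k).2), hD, hD, neg_add]
      map_smul' := fun a g => hM.eq_of_integral_mul_eq hK fun f => by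
        have h1 : ∀ x, f.1 x * (a • D g).1 x = a * (f.1 x * (D g).1 x) :=
          fun x => mul_left_comm _ _ _
        have h2 : ∀ x, gradientInner f.1 (a • g).1 x = a * gradientInner f.1 g.1 x :=
          hM.gradientInner_smul_right f.2 g.2 a
        rw [hD]
        simp only [h1, h2, RingHom.id_apply]
        rw [integral_const_mul, integral_const_mul, hD, mul_neg] }
  refine ⟨Δ, hD, fun Δ' hΔ' => LinearMap.ext fun g => hM.eq_of_integral_mul_eq hK fun f => ?_⟩
  exact (hΔ' f g).trans (hD f g).symm

/-- The carré du champ identity `½ Δ(f²) - f Δf = |∇f|²`. -/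
theorem HasCharts.carre_du_champ (hM : HasCharts d M) (hK : IsCompact M)
    {Δ : SmoothFunctions M →ₗ[ℝ] SmoothFunctions M} (hΔ : IsLaplaceBeltrami d Δ)
    (f : SmoothFunctions M) :
    ((1 / 2 : ℝ) • Δ (f ^ 2) - f * Δ f).1 = gradientInner f.1 f.1 := by
  have hff := hM.isSmoothFunction_gradientInner f.2 f.2
  suffices (1 / 2 : ℝ) • Δ (f ^ 2) - f * Δ f = ⟨gradientInner f.1 f.1, hff⟩ from
    congrArg Subtype.val this
  -- Weakly, the left side is `∫ ∇(kf)·∇f - ½ ∫ ∇k·∇(f²)`; the two terms `f ∇k·∇f` cancel and `∫ k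
  -- |∇f|²` remains.
  refine hM.eq_of_integral_mul_eq hK fun k => ?_
  have hΔ' : ∀ f g : SmoothFunctions M, ∫ x, f.1 x * (Δ g).1 x ∂(μHE[d] : Measure M) =
      -∫ x, gradientInner f.1 g.1 x ∂(μHE[d] : Measure M) := hΔ
  have h1 : ∀ x, k.1 x * ((1 / 2 : ℝ) • Δ (f ^ 2) - f * Δ f).1 x =
      (1 / 2) * (k.1 x * (Δ (f ^ 2)).1 x) - (k * f).1 x * (Δ f).1 x := fun x => by
    change k.1 x * ((1 / 2) * (Δ (f ^ 2)).1 x - f.1 x * (Δ f).1 x) =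
      (1 / 2) * (k.1 x * (Δ (f ^ 2)).1 x) - (k.1 x * f.1 x) * (Δ f).1 x
    ring
  have hi1 := hM.integrable hK (hM.isSmoothFunction_gradientInner k.2 (f ^ 2).2)
  have hi2 := hM.integrable hK (hM.isSmoothFunction_gradientInner (k * f).2 f.2)
  simp only [h1]
  rw [integral_sub ((hM.integrable_mul hK k.2 (Δ (f ^ 2)).2).const_mul _)
    (hM.integrable_mul hK (k * f).2 (Δ f).2), integral_const_mul, hΔ', hΔ', mul_neg, sub_neg_eq_add,
    neg_add_eq_sub, ← integral_const_mul, ← integral_sub hi2 (hi1.const_mul _)]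
  refine integral_congr_ae (.of_forall fun x => ?_)
  have h2 : gradientInner k.1 (f ^ 2).1 x = 2 * (f.1 x * gradientInner f.1 k.1 x) := by
    rw [gradientInner_comm, pow_two]
    refine (hM.gradientInner_mul_left f.2 f.2 k.2 x).trans ?_
    ring
  have h3 := hM.gradientInner_mul_left k.2 f.2 f.2 x
  change gradientInner (k.1 * f.1) f.1 x - 1 / 2 * gradientInner k.1 (f ^ 2).1 x
    = k.1 x * gradientInner f.1 f.1 x
  rw [h2, h3, gradientInner_comm k.1]
  ring

end

/-! ### Path lengths and the intrinsic distance -/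

section

variable {N d : ℕ} {M : Set (𝔼 N)}

/-- The lengths of the smooth paths in `M` from `x` to `y`. -/
def pathLengths (x y : M) : Set ℝ :=
  {L : ℝ | ∃ γ : ℝ → EuclideanSpace ℝ (Fin N),
    ContDiffOn ℝ ∞ γ (Icc 0 1) ∧ (∀ t ∈ Icc (0 : ℝ) 1, γ t ∈ M) ∧ γ 0 = x ∧ γ 1 = y ∧
    L = ∫ t in (0 : ℝ)..1, ‖derivWithin γ (Icc 0 1) t‖}

theorem pathLengths_nonneg {x y : M} {L : ℝ} (hL : L ∈ pathLengths x y) : 0 ≤ L := by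
  obtain ⟨γ, -, -, -, -, rfl⟩ := hL
  exact intervalIntegral.integral_nonneg zero_le_one fun t _ => norm_nonneg _

theorem intrinsicDist_le {x y : M} {L : ℝ} (hL : L ∈ pathLengths x y) : intrinsicDist M x y ≤ L :=
  csInf_le ⟨0, fun _ h => pathLengths_nonneg h⟩ hL

theorem zero_mem_pathLengths (x : M) : (0 : ℝ) ∈ pathLengths x x :=
  ⟨fun _ => x, contDiffOn_const, fun _ _ => x.2, rfl, rfl, by simp⟩

theorem intrinsicDist_self (x : M) : intrinsicDist M x x = 0 :=
  le_antisymm (intrinsicDist_le (zero_mem_pathLengths x))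
    (Real.sInf_nonneg fun _ h => pathLengths_nonneg h)

theorem hasDerivAt_comp_derivWithin {E : Type*} [NormedAddCommGroup E] [NormedSpace ℝ E]
    {γ : ℝ → E} (hγ : ContDiffOn ℝ ∞ γ (Icc 0 1)) {s : ℝ → ℝ} (hs : ContDiff ℝ ∞ s)
    (hs01 : ∀ t, s t ∈ Icc (0 : ℝ) 1) (t : ℝ) :
    HasDerivAt (fun t => γ (s t)) (deriv s t • derivWithin γ (Icc 0 1) (s t)) t :=
  (((hγ.differentiableOn (by simp)) (s t) (hs01 t)).hasDerivWithinAt).scomp_hasDerivAt t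
    (hs.differentiable (by simp) t).hasDerivAt hs01

theorem integral_norm_deriv_comp {E : Type*} [NormedAddCommGroup E] [NormedSpace ℝ E]
    {γ : ℝ → E} (hγ : ContDiffOn ℝ ∞ γ (Icc 0 1)) {s : ℝ → ℝ} (hs : ContDiff ℝ ∞ s)
    (hs01 : ∀ t, s t ∈ Icc (0 : ℝ) 1) (hmono : Monotone s) {a b : ℝ} (ha : s a = 0)
    (hb : s b = 1) :
    ∫ t in a..b, ‖deriv (fun t => γ (s t)) t‖ = ∫ t in (0 : ℝ)..1, ‖derivWithin γ (Icc 0 1) t‖ := by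
  have h1 : ∀ t, ‖deriv (fun t => γ (s t)) t‖ =
      ((fun r => ‖derivWithin γ (Icc 0 1) r‖) ∘ s) t * deriv s t := fun t => by
    rw [(hasDerivAt_comp_derivWithin hγ hs hs01 t).deriv, norm_smul, Real.norm_eq_abs,
      abs_of_nonneg (hmono.deriv_nonneg), mul_comm]
    rfl
  simp only [h1]
  rw [intervalIntegral.integral_comp_mul_deriv'
    (fun t _ => (hs.differentiable (by simp) t).hasDerivAt)
    (hs.continuous_deriv (by simp)).continuousOn, ha, hb]
  refine ((hγ.continuousOn_derivWithin (uniqueDiffOn_Icc zero_lt_one) (by simp)).norm).mono ?_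
  rintro _ ⟨t, -, rfl⟩
  exact hs01 t

/-- Each path is reparametrized monotonically so as to be constant around the junction; the
concatenation is then smooth, and lengths do not change. -/
theorem add_mem_pathLengths {x y z : M} {K L : ℝ} (hK : K ∈ pathLengths x y)
    (hL : L ∈ pathLengths y z) : K + L ∈ pathLengths x z := by
  obtain ⟨γ₁, h1, h1M, h10, h11, rfl⟩ := hK
  obtain ⟨γ₂, h2, h2M, h20, h21, rfl⟩ := hL
  -- `s₁` has reached 1 by time `1/3` and `s₂` stays 0 until `2/3`, so both formulas agree on the
  -- middle third and the cut at `1/2` is harmless.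
  let s₁ : ℝ → ℝ := fun t => Real.smoothTransition (3 * t)
  let s₂ : ℝ → ℝ := fun t => Real.smoothTransition (3 * t - 2)
  have hs₁ : ContDiff ℝ ∞ s₁ := Real.smoothTransition.contDiff.comp (by fun_prop)
  have hs₂ : ContDiff ℝ ∞ s₂ := Real.smoothTransition.contDiff.comp (by fun_prop)
  have hm₁ : Monotone s₁ := fun a b h => Real.smoothTransition.monotone (by linarith)
  have hm₂ : Monotone s₂ := fun a b h => Real.smoothTransition.monotone (by linarith)
  have h01₁ : ∀ t, s₁ t ∈ Icc (0 : ℝ) 1 := fun t =>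
    ⟨Real.smoothTransition.nonneg _, Real.smoothTransition.le_one _⟩
  have h01₂ : ∀ t, s₂ t ∈ Icc (0 : ℝ) 1 := fun t =>
    ⟨Real.smoothTransition.nonneg _, Real.smoothTransition.le_one _⟩
  have hone : ∀ t : ℝ, 1 / 3 ≤ t → s₁ t = 1 := fun t ht =>
    Real.smoothTransition.one_of_one_le (by linarith)
  have hzero : ∀ t : ℝ, t ≤ 2 / 3 → s₂ t = 0 := fun t ht =>
    Real.smoothTransition.zero_of_nonpos (by linarith)
  have hs₁0 : s₁ 0 = 0 := Real.smoothTransition.zero_of_nonpos (by norm_num)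
  have hs₂1 : s₂ 1 = 1 := Real.smoothTransition.one_of_one_le (by norm_num)
  let η : ℝ → 𝔼 N := fun t => if t < 1 / 2 then γ₁ (s₁ t) else γ₂ (s₂ t)
  have hη₁ : ∀ t : ℝ, t < 2 / 3 → η t = γ₁ (s₁ t) := fun t ht => by
    by_cases h : t < 1 / 2
    · simp only [η, if_pos h]
    · simp only [η, if_neg h]
      rw [hzero t ht.le, hone t (by linarith), h20, h11]
  have hη₂ : ∀ t : ℝ, 1 / 3 < t → η t = γ₂ (s₂ t) := fun t ht => by
    by_cases h : t < 1 / 2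
    · simp only [η, if_pos h]
      rw [hzero t (by linarith), hone t ht.le, h20, h11]
    · simp only [η, if_neg h]
  have hev₁ : ∀ t : ℝ, t < 2 / 3 → η =ᶠ[𝓝 t] fun t => γ₁ (s₁ t) := fun t ht => by
    filter_upwards [Iio_mem_nhds ht] with r hr using hη₁ r hr
  have hev₂ : ∀ t : ℝ, 1 / 3 < t → η =ᶠ[𝓝 t] fun t => γ₂ (s₂ t) := fun t ht => by
    filter_upwards [Ioi_mem_nhds ht] with r hr using hη₂ r hr
  have hc₁ : ContDiff ℝ ∞ fun t => γ₁ (s₁ t) :=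
    contDiffOn_univ.1 (h1.comp hs₁.contDiffOn fun t _ => h01₁ t)
  have hc₂ : ContDiff ℝ ∞ fun t => γ₂ (s₂ t) :=
    contDiffOn_univ.1 (h2.comp hs₂.contDiffOn fun t _ => h01₂ t)
  have hη : ContDiff ℝ ∞ η := contDiff_iff_contDiffAt.2 fun t => by
    rcases lt_or_ge t (1 / 2) with h | h
    · exact hc₁.contDiffAt.congr_of_eventuallyEq (hev₁ t (by linarith))
    · exact hc₂.contDiffAt.congr_of_eventuallyEq (hev₂ t (by linarith))
  have hdη : Continuous fun t => ‖deriv η t‖ := (hη.continuous_deriv (by simp)).norm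
  refine ⟨η, hη.contDiffOn, fun t _ => ?_, ?_, ?_, ?_⟩
  · by_cases h : t < 1 / 2
    · simp only [η, if_pos h]
      exact h1M _ (h01₁ t)
    · simp only [η, if_neg h]
      exact h2M _ (h01₂ t)
  · rw [hη₁ 0 (by norm_num), hs₁0, h10]
  · rw [hη₂ 1 (by norm_num), hs₂1, h21]
  · have e0 : ∫ t in (0 : ℝ)..1, ‖derivWithin η (Icc 0 1) t‖ = ∫ t in (0 : ℝ)..1, ‖deriv η t‖ := by
      refine intervalIntegral.integral_congr fun t ht => ?_
      rw [uIcc_of_le zero_le_one] at ht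
      rw [(hη.differentiable (by simp) t).derivWithin (uniqueDiffOn_Icc zero_lt_one t ht)]
    have e1 : ∫ t in (0 : ℝ)..(1 / 2), ‖deriv η t‖ =
        ∫ t in (0 : ℝ)..(1 / 2), ‖deriv (fun t => γ₁ (s₁ t)) t‖ := by
      refine intervalIntegral.integral_congr fun t ht => ?_
      rw [uIcc_of_le (by norm_num)] at ht
      rw [(hev₁ t (by linarith [ht.2])).deriv_eq]
    have e2 : ∫ t in (1 / 2 : ℝ)..1, ‖deriv η t‖ =
        ∫ t in (1 / 2 : ℝ)..1, ‖deriv (fun t => γ₂ (s₂ t)) t‖ := by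
      refine intervalIntegral.integral_congr fun t ht => ?_
      rw [uIcc_of_le (by norm_num)] at ht
      rw [(hev₂ t (by linarith [ht.1])).deriv_eq]
    rw [e0, ← intervalIntegral.integral_add_adjacent_intervals (b := (1 / 2 : ℝ))
      (hdη.intervalIntegrable _ _) (hdη.intervalIntegrable _ _), e1, e2,
      integral_norm_deriv_comp h1 hs₁ h01₁ hm₁ hs₁0 (hone _ (by norm_num)),
      integral_norm_deriv_comp h2 hs₂ h01₂ hm₂ (hzero _ (by norm_num)) hs₂1]

/-- The path is a straight segment in coordinates. One factor `κ` bounds its speed by the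
differential at `u₀`, the other compares that with the chord. -/
theorem Chart.exists_pathLength_le (c : Chart d M) (u₀ : 𝔼 d) {κ : ℝ} (hκ : 1 < κ) :
    ∃ r > 0, ∀ u ∈ ball u₀ r, ∀ v ∈ ball u₀ r, ∃ L ∈ pathLengths (c.param u) (c.param v),
      L ≤ κ ^ 2 * ‖c.ambient u - c.ambient v‖ := by
  obtain ⟨r, hr, hd, hbil⟩ := c.exists_ball_bilipschitz u₀ hκ
  refine ⟨r, hr, fun u hu v hv => ⟨_, ⟨fun t => c.ambient (u + t • (v - u)), ?_,
    fun t _ => (c.param _).2, ?_, ?_, rfl⟩, ?_⟩⟩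
  · exact (c.contDiff_ambient.comp
      (contDiff_const.add (contDiff_id.smul contDiff_const))).contDiffOn
  · simp [Chart.ambient]
  · simp [Chart.ambient]
  · have hb : ∀ t ∈ uIoc (0 : ℝ) 1,
        ‖‖derivWithin (fun t => c.ambient (u + t • (v - u))) (Icc 0 1) t‖‖ ≤
          κ * ‖c.differential u₀ (u - v)‖ := fun t ht => by
      rw [uIoc_of_le zero_le_one] at ht
      have ht' := Ioc_subset_Icc_self ht
      have hl : HasDerivAt (fun t : ℝ => u + t • (v - u)) (v - u) t := by
        simpa using ((hasDerivAt_id t).smul_const (v - u)).const_add u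
      have hmem : u + t • (v - u) ∈ ball u₀ r :=
        (convex_ball u₀ r).add_smul_sub_mem hu hv ht'
      have h1 : HasDerivAt (fun t : ℝ => c.ambient (u + t • (v - u)))
          (c.differential (u + t • (v - u)) (v - u)) t :=
        (c.hasFDerivAt_ambient (u + t • (v - u))).comp_hasDerivAt_of_eq t hl rfl
      rw [norm_norm, h1.hasDerivWithinAt.derivWithin (uniqueDiffOn_Icc zero_lt_one t ht'),
        ← neg_sub v u, map_neg, norm_neg]
      exact hd _ hmem _
    have h2 := intervalIntegral.norm_integral_le_of_norm_le_const hb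
    have h3 := (hbil u hu v hv).2
    rw [sub_zero, abs_one, mul_one] at h2
    calc _ ≤ _ := Real.le_norm_self _
      _ ≤ κ * ‖c.differential u₀ (u - v)‖ := h2
      _ ≤ κ * (κ * ‖c.ambient u - c.ambient v‖) := by gcongr
      _ = _ := by ring

theorem HasCharts.exists_open_pathLength_le (hM : HasCharts d M) (x : M) {κ : ℝ} (hκ : 1 < κ) :
    ∃ W : Set (𝔼 N), IsOpen W ∧ (x : 𝔼 N) ∈ W ∧ ∀ y z : M, (y : 𝔼 N) ∈ W → (z : 𝔼 N) ∈ W →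
      ∃ L ∈ pathLengths y z, L ≤ κ ^ 2 * ‖(y : 𝔼 N) - z‖ := by
  obtain ⟨c, u₀, rfl⟩ := hM x
  obtain ⟨r, hr, h⟩ := c.exists_pathLength_le u₀ hκ
  obtain ⟨W, hW, hWr⟩ := isOpen_induced_iff.1
    (c.isOpenEmbedding_param.isOpenMap _ (isOpen_ball (x := u₀) (ε := r)))
  have hmem : ∀ y : M, (y : 𝔼 N) ∈ W ↔ y ∈ c.param '' ball u₀ r := fun y => by rw [← hWr]; rfl
  refine ⟨W, hW, (hmem _).2 ⟨u₀, mem_ball_self hr, rfl⟩, fun y z hy hz => ?_⟩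
  obtain ⟨u, hu, rfl⟩ := (hmem y).1 hy
  obtain ⟨v, hv, rfl⟩ := (hmem z).1 hz
  exact h u hu v hv

/-- Nearby points are joined in both directions and paths concatenate, so connectedness applies.
Nonemptiness matters because `sInf ∅` would be 0. -/
theorem HasCharts.pathLengths_nonempty (hM : HasCharts d M) (hconn : IsConnected M) (x y : M) :
    (pathLengths x y).Nonempty := by
  have := isPreconnected_iff_preconnectedSpace.1 hconn.isPreconnected
  refine PreconnectedSpace.induction₂' (fun x y : M => (pathLengths x y).Nonempty) (fun x => ?_)
    ⟨fun x y z ⟨K, hK⟩ ⟨L, hL⟩ => ⟨K + L, add_mem_pathLengths hK hL⟩⟩ x y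
  obtain ⟨W, hW, hxW, h⟩ := hM.exists_open_pathLength_le x one_lt_two
  filter_upwards [(hW.preimage continuous_subtype_val).mem_nhds hxW] with y hy
  obtain ⟨L, hL, -⟩ := h x y hxW hy
  obtain ⟨K, hK, -⟩ := h y x hy hxW
  exact ⟨⟨L, hL⟩, ⟨K, hK⟩⟩

theorem HasCharts.intrinsicDist_le_add (hM : HasCharts d M) (hconn : IsConnected M) {x y z : M}
    {L : ℝ} (hL : L ∈ pathLengths y z) : intrinsicDist M x z ≤ intrinsicDist M x y + L := by
  rw [← sub_le_iff_le_add]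
  exact le_csInf (hM.pathLengths_nonempty hconn x y) fun K hK =>
    sub_le_iff_le_add.2 (intrinsicDist_le (add_mem_pathLengths hK hL))

/-- The gradient is defined through curves on all of `ℝ`, while paths live on `[0, 1]`; this is the
chain rule for derivatives within a set, endpoints included. -/
theorem Chart.hasDerivWithinAt_comp_curve (c : Chart d M) {f : M → ℝ} (hf : IsSmoothFunction f)
    {γ : ℝ → M} {S : Set ℝ} {t : ℝ} {γ' : 𝔼 N}
    (hγ : HasDerivWithinAt (fun r => (γ r : 𝔼 N)) γ' S t) (ht : γ t ∈ range c.param) (htS : t ∈ S)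
    (hS : UniqueDiffWithinAt ℝ S t) :
    HasDerivWithinAt (fun r => f (γ r)) (inner ℝ (manifoldGradient f (γ t)) γ') S t := by
  obtain ⟨u, hu⟩ := ht
  have hcont : ContinuousWithinAt γ S t :=
    IsInducing.subtypeVal.continuousWithinAt_iff.2 hγ.continuousWithinAt
  have hev : ∀ᶠ r in 𝓝[S] t, c.param (c.coord (γ r)) = γ r := by
    filter_upwards [hcont (c.isOpen_range.mem_nhds ⟨u, hu⟩)] with r hr
    exact c.param_coord hr
  have hut : u = c.coord (γ t) := by rw [← hu, c.coord_param]
  have hcd : HasFDerivAt c.coord (fderiv ℝ c.coord (c.param u)) (c.param u : 𝔼 N) :=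
    ((c.contDiffAt_coord u).differentiableAt (by simp)).hasFDerivAt
  set w : 𝔼 d := fderiv ℝ c.coord (c.param u) γ'
  have hw : HasDerivWithinAt (fun r => c.coord (γ r)) w S t :=
    hcd.comp_hasDerivWithinAt_of_eq t hγ (by rw [hu])
  have h1 : HasDerivWithinAt (fun r => (γ r : 𝔼 N)) (c.differential u w) S t :=
    ((c.hasFDerivAt_ambient u).comp_hasDerivWithinAt_of_eq t hw hut).congr_of_eventuallyEq
      (by filter_upwards [hev] with r hr using congrArg Subtype.val hr.symm)
      (congrArg Subtype.val (hev.self_of_nhdsWithin htS).symm)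
  -- Uniqueness of the derivative within `S` shows that `γ'` is tangent to `M`.
  have h2 : γ' = c.differential u w := hS.eq_deriv S hγ h1
  rw [h2, ← hu, (c.isGradientAt_param hf u).manifoldGradient_eq,
    c.inner_differential_gradientCoord]
  have hfd := ((c.contDiff_comp_param hf).differentiable (by simp) u).hasFDerivAt
  refine (hfd.comp_hasDerivWithinAt_of_eq t hw hut).congr_of_eventuallyEq ?_ ?_
  · filter_upwards [hev] with r hr
    simp [hr]
  · simp [hev.self_of_nhdsWithin htS]

theorem HasCharts.sub_le_pathLength (hM : HasCharts d M) {f : M → ℝ} (hf : IsSmoothFunction f)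
    (hgrad : ∀ x, ‖manifoldGradient f x‖ ≤ 1) {x y : M} {L : ℝ} (hL : L ∈ pathLengths x y) :
    |f x - f y| ≤ L := by
  obtain ⟨γ, hγ, hγM, h0, h1, rfl⟩ := hL
  -- Clamping time gives a map into `M` on all of `ℝ`; only its values on `[0, 1]` are used.
  let δ : ℝ → M := fun t => ⟨γ (projIcc 0 1 zero_le_one t), hγM _ (projIcc 0 1 zero_le_one t).2⟩
  have hδ : ∀ t ∈ Icc (0 : ℝ) 1, (δ t : 𝔼 N) = γ t := fun t ht => by
    simp [δ, projIcc_of_mem _ ht]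
  have hδ0 : δ 0 = x := Subtype.ext ((hδ 0 (by simp)).trans h0)
  have hδ1 : δ 1 = y := Subtype.ext ((hδ 1 (by simp)).trans h1)
  have hder : ∀ t ∈ Icc (0 : ℝ) 1, HasDerivWithinAt (fun r => f (δ r))
      (inner ℝ (manifoldGradient f (δ t)) (derivWithin γ (Icc 0 1) t)) (Icc 0 1) t := by
    intro t ht
    obtain ⟨c, hc⟩ := hM (δ t)
    refine c.hasDerivWithinAt_comp_curve hf ?_ hc ht (uniqueDiffOn_Icc zero_lt_one t ht)
    exact ((hγ.differentiableOn (by simp)) t ht).hasDerivWithinAt.congr hδ (hδ t ht)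
  have hbound : ∀ t, |inner ℝ (manifoldGradient f (δ t)) (derivWithin γ (Icc 0 1) t)| ≤
      ‖derivWithin γ (Icc 0 1) t‖ := fun t =>
    (abs_real_inner_le_norm _ _).trans (mul_le_of_le_one_left (norm_nonneg _) (hgrad _))
  have hcont : ContinuousOn (fun r => f (δ r)) (Icc 0 1) := fun t ht =>
    (hder t ht).continuousWithinAt
  have hint : IntegrableOn (fun t => ‖derivWithin γ (Icc 0 1) t‖) (Icc 0 1) :=
    (hγ.continuousOn_derivWithin (uniqueDiffOn_Icc zero_lt_one) (by simp)).norm.integrableOn_Icc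
  have hright : ∀ t ∈ Ioo (0 : ℝ) 1, HasDerivWithinAt (fun r => f (δ r))
      (inner ℝ (manifoldGradient f (δ t)) (derivWithin γ (Icc 0 1) t)) (Ioi t) t := fun t ht =>
    ((hder t (Ioo_subset_Icc_self ht)).hasDerivAt (Icc_mem_nhds ht.1 ht.2)).hasDerivWithinAt
  have e1 := intervalIntegral.sub_le_integral_of_hasDeriv_right_of_le zero_le_one hcont hright hint
    fun t _ => (le_abs_self _).trans (hbound t)
  have e2 := intervalIntegral.sub_le_integral_of_hasDeriv_right_of_le zero_le_one hcont.neg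
    (fun t ht => (hright t ht).neg) hint fun t _ => (neg_le_abs _).trans (hbound t)
  simp only [Pi.neg_apply, hδ0, hδ1] at e1 e2
  rw [abs_le]
  constructor <;> linarith

end

/-! ### Smooth approximation of Lipschitz functions -/

/-- Mollification: a Lipschitz function is uniformly approximated by smooth functions with the same
Lipschitz constant. -/
theorem LipschitzWith.exists_contDiff_approx {N : ℕ} {K : NNReal} {f : 𝔼 N → ℝ}
    (hf : LipschitzWith K f) {δ : ℝ} (hδ : 0 < δ) :
    ∃ g : 𝔼 N → ℝ, ContDiff ℝ ∞ g ∧ LipschitzWith K g ∧ ∀ x, |g x - f x| ≤ δ := by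
  -- Moving a point by this radius changes `f` by at most `δ`; the `+ 1` covers `K = 0`.
  have hr : 0 < δ / (K + 1) := by positivity
  let φ : ContDiffBump (0 : 𝔼 N) := ⟨δ / (K + 1) / 2, δ / (K + 1), by positivity, by linarith⟩
  let g : 𝔼 N → ℝ :=
    convolution (φ.normed volume) f (ContinuousLinearMap.lsmul ℝ ℝ) volume
  have hg : ∀ x, g x = ∫ t, φ.normed volume t * f (x - t) := fun x => rfl
  have hint : ∀ x, Integrable fun t => φ.normed volume t * f (x - t) := fun x =>
    (φ.continuous_normed.mul (hf.continuous.comp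
      (continuous_const.sub continuous_id))).integrable_of_hasCompactSupport
      φ.hasCompactSupport_normed.mul_right
  refine ⟨g, ?_, ?_, fun x => ?_⟩
  · exact φ.hasCompactSupport_normed.contDiff_convolution_left _ φ.contDiff_normed
      hf.continuous.locallyIntegrable
  · refine LipschitzWith.of_dist_le_mul fun x y => ?_
    rw [dist_eq_norm, hg, hg, ← integral_sub (hint x) (hint y)]
    calc _ ≤ ∫ t, φ.normed volume t * (K * dist x y) := by
          refine norm_integral_le_of_norm_le (φ.integrable_normed.mul_const _) (.of_forall fun t => ?_)
          rw [← mul_sub, norm_mul, Real.norm_of_nonneg (φ.nonneg_normed t)]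
          refine mul_le_mul_of_nonneg_left ?_ (φ.nonneg_normed t)
          rw [← dist_eq_norm]
          simpa using hf.dist_le_mul (x - t) (y - t)
      _ = _ := by rw [integral_mul_const, φ.integral_normed, one_mul]
  · rw [← Real.dist_eq]
    refine ContDiffBump.dist_normed_convolution_le hf.continuous.aestronglyMeasurable
      fun y hy => ?_
    calc dist (f y) (f x) ≤ K * dist y x := hf.dist_le_mul y x
      _ ≤ K * (δ / (K + 1)) := by gcongr; exact (mem_ball.1 hy).le
      _ ≤ δ := by
        rw [mul_div_assoc', div_le_iff₀ (by positivity)]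
        nlinarith [K.coe_nonneg]

section

variable {N d : ℕ} {M : Set (𝔼 N)}

theorem IsSmoothCurveAt.hasDerivAt_comp {x : M} {γ : ℝ → M} (hγ : IsSmoothCurveAt x γ)
    {F : 𝔼 N → ℝ} (hF : ContDiff ℝ ∞ F) :
    HasDerivAt (fun t => F (γ t)) (fderiv ℝ F x (velocity γ)) 0 :=
  (hF.differentiable (by simp) x).hasFDerivAt.comp_hasDerivAt_of_eq (0 : ℝ)
    (hγ.1.differentiable (by simp) 0).hasDerivAt (by rw [hγ.2])

/-- The restriction to `M ∩ W` extends to the ambient space with the same constant, and the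
extension is mollified. -/
theorem exists_contDiff_approx_of_lipschitz_on (f : M → ℝ) {W : Set (𝔼 N)} {K : NNReal}
    (hf : ∀ y z : M, (y : 𝔼 N) ∈ W → (z : 𝔼 N) ∈ W → |f y - f z| ≤ K * ‖(y : 𝔼 N) - z‖)
    {δ : ℝ} (hδ : 0 < δ) :
    ∃ g : 𝔼 N → ℝ, ContDiff ℝ ∞ g ∧ LipschitzWith K g ∧
      ∀ y : M, (y : 𝔼 N) ∈ W → |g y - f y| ≤ δ := by
  classical
  let f' : 𝔼 N → ℝ := fun y => if h : y ∈ M then f ⟨y, h⟩ else 0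
  have hf' : ∀ y : M, f' y = f y := fun y => dif_pos y.2
  have hlip : LipschitzOnWith K f' (M ∩ W) := by
    refine LipschitzOnWith.of_dist_le_mul fun y hy z hz => ?_
    rw [dist_eq_norm y z, Real.dist_eq, hf' ⟨y, hy.1⟩, hf' ⟨z, hz.1⟩]
    exact hf ⟨y, hy.1⟩ ⟨z, hz.1⟩ hy.2 hz.2
  obtain ⟨k, hk, heq⟩ := hlip.extend_real
  obtain ⟨g, hg, hgl, hgk⟩ := hk.exists_contDiff_approx hδ
  refine ⟨g, hg, hgl, fun y hy => ?_⟩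
  rw [← hf', heq ⟨y.2, hy⟩]
  exact hgk y

/-- A locally `K`-Lipschitz function on `M` is uniformly approximated by smooth functions whose
gradients are only slightly longer than `K`. -/
theorem HasCharts.exists_smooth_approx (hM : HasCharts d M) (hK : IsCompact M) (f : M → ℝ)
    {K : NNReal}
    (hf : ∀ x : M, ∃ W : Set (𝔼 N), IsOpen W ∧ (x : 𝔼 N) ∈ W ∧ ∀ y z : M, (y : 𝔼 N) ∈ W →
      (z : 𝔼 N) ∈ W → |f y - f z| ≤ K * ‖(y : 𝔼 N) - z‖) {ε : ℝ} (hε : 0 < ε) :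
    ∃ G : M → ℝ, IsSmoothFunction G ∧ (∀ x, ‖manifoldGradient G x‖ ≤ K + ε) ∧
      ∀ x, |G x - f x| ≤ ε := by
  choose W hW hxW hfW using hf
  obtain ⟨s, χ, hχ, hχ0, hχW, hχ1⟩ := exists_finite_smooth_partition hK W hW hxW
  have hcont : Continuous fun x => ∑ i, ‖fderiv ℝ (χ i) x‖ :=
    continuous_finsetSum _ fun i _ => ((hχ i).continuous_fderiv (by simp)).norm
  obtain ⟨C, hC⟩ := hK.exists_bound_of_continuousOn hcont.continuousOn
  have hC' : ∀ x : M, ∑ i, ‖fderiv ℝ (χ i) x‖ ≤ |C| := fun x =>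
    (Real.le_norm_self _).trans ((hC x x.2).trans (le_abs_self C))
  -- Gluing adds the error `∑ (F i - f) ∇χ i` to the gradient; this `δ` keeps it below `ε`.
  set δ : ℝ := ε / (|C| + 1) with hδdef
  have hδ : 0 < δ := by positivity
  have hδε : δ ≤ ε := div_le_self hε.le (by linarith [abs_nonneg C])
  have hδC : δ * |C| ≤ ε := by
    rw [hδdef, div_mul_eq_mul_div, div_le_iff₀ (by positivity)]
    nlinarith [abs_nonneg C]
  choose F hF hFlip hFf using fun i : s => exists_contDiff_approx_of_lipschitz_on f (hfW i) hδ
  let G : 𝔼 N → ℝ := fun y => ∑ i, χ i y * F i y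
  have hG : ContDiff ℝ ∞ G := ContDiff.sum fun i _ => (hχ i).mul (hF i)
  have hGs : IsSmoothFunction (fun x : M => G x) := isSmoothFunction_of_contDiff hG
  refine ⟨fun x => G x, hGs, fun x => ?_, fun x => ?_⟩
  · obtain ⟨⟨γ, hγ, hv⟩, hgrad⟩ := hM.isGradientAt hGs x
    set v := manifoldGradient (fun x : M => G x) x
    -- The functions `χ i` sum to 1 only on `M`, so the sum of their derivatives is known to vanish
    -- only in tangent directions; `v` is one, being the velocity of `γ`.
    have hχv : ∑ i, fderiv ℝ (χ i) x v = 0 := by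
      have h1 : HasDerivAt (fun t => ∑ i, χ i (γ t)) (∑ i, fderiv ℝ (χ i) x (velocity γ)) 0 :=
        HasDerivAt.fun_sum fun i _ => hγ.hasDerivAt_comp (hχ i)
      have h2 : (fun t => ∑ i, χ i (γ t)) = fun _ => 1 := funext fun t => hχ1 _ (γ t).2
      rw [h2, hv] at h1
      exact h1.unique (hasDerivAt_const 0 1)
    have hGv : ‖v‖ * ‖v‖ = fderiv ℝ G x v := by
      have := hgrad γ hγ
      rw [(hγ.hasDerivAt_comp hG).deriv, hv, real_inner_self_eq_norm_mul_norm] at this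
      exact this.symm
    -- By `hχv` the constant `f x` may be subtracted from each `F i x`; `f` itself is never
    -- differentiated.
    have hdG : fderiv ℝ G x v =
        ∑ i, (χ i x * fderiv ℝ (F i) x v + (F i x - f x) * fderiv ℝ (χ i) x v) := by
      have h1 : HasFDerivAt G (∑ i, (χ i x • fderiv ℝ (F i) x + F i x • fderiv ℝ (χ i) x)) x :=
        HasFDerivAt.fun_sum fun i _ => ((hχ i).differentiable (by simp) x).hasFDerivAt.mul
          ((hF i).differentiable (by simp) x).hasFDerivAt
      rw [h1.fderiv]
      simp only [_root_.sum_apply, _root_.add_apply,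
        _root_.smul_apply, smul_eq_mul, sub_mul, Finset.sum_add_distrib,
        Finset.sum_sub_distrib, ← Finset.mul_sum, hχv, mul_zero, sub_zero]
    have hterm : ∀ i, χ i x * fderiv ℝ (F i) x v + (F i x - f x) * fderiv ℝ (χ i) x v ≤
        χ i x * (K * ‖v‖) + δ * (‖fderiv ℝ (χ i) x‖ * ‖v‖) := fun i => by
      refine add_le_add (mul_le_mul_of_nonneg_left ?_ (hχ0 i x)) ?_
      · exact (Real.le_norm_self _).trans ((fderiv ℝ (F i) x).le_of_opNorm_le
          (norm_fderiv_le_of_lipschitz ℝ (hFlip i)) v)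
      · by_cases hx : (x : 𝔼 N) ∈ tsupport (χ i)
        · refine (le_abs_self _).trans ?_
          rw [abs_mul]
          exact mul_le_mul (hFf i x (hχW i hx)) ((fderiv ℝ (χ i) x).le_opNorm v) (abs_nonneg _)
            hδ.le
        · have : fderiv ℝ (χ i) x = 0 := by
            by_contra h
            exact hx (support_fderiv_subset ℝ h)
          simp [this]
    have hsum : ‖v‖ * ‖v‖ ≤ (K + ε) * ‖v‖ := by
      rw [hGv, hdG]
      calc _ ≤ ∑ i, (χ i x * (K * ‖v‖) + δ * (‖fderiv ℝ (χ i) x‖ * ‖v‖)) :=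
            Finset.sum_le_sum fun i _ => hterm i
        _ = K * ‖v‖ + δ * (∑ i, ‖fderiv ℝ (χ i) x‖) * ‖v‖ := by
            rw [Finset.sum_add_distrib, ← Finset.sum_mul, hχ1 x x.2, one_mul, ← Finset.mul_sum,
              ← Finset.sum_mul, mul_assoc]
        _ ≤ K * ‖v‖ + δ * |C| * ‖v‖ := by gcongr; exact hC' x
        _ ≤ K * ‖v‖ + ε * ‖v‖ := by gcongr
        _ = _ := by ring
    rcases (norm_nonneg v).eq_or_lt with h | h
    · rw [← h]; positivity
    · exact le_of_mul_le_mul_right hsum h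
  · have h1 : G x - f x = ∑ i, χ i x * (F i x - f x) := by
      simp only [mul_sub, Finset.sum_sub_distrib, ← Finset.sum_mul, hχ1 x x.2, one_mul, G]
    rw [h1]
    calc _ ≤ ∑ i, |χ i x * (F i x - f x)| := Finset.abs_sum_le_sum_abs _ _
      _ ≤ ∑ i, χ i x * δ := Finset.sum_le_sum fun i _ => by
          rw [abs_mul, abs_of_nonneg (hχ0 i x)]
          by_cases hx : (x : 𝔼 N) ∈ tsupport (χ i)
          · exact mul_le_mul_of_nonneg_left (hFf i x (hχW i hx)) (hχ0 i x)
          · simp [image_eq_zero_of_notMem_tsupport hx]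
      _ = δ := by rw [← Finset.sum_mul, hχ1 x x.2, one_mul]
      _ ≤ ε := hδε

theorem HasCharts.exists_smooth_approx_intrinsicDist (hM : HasCharts d M) (hK : IsCompact M)
    (hconn : IsConnected M) (x : M) {ε : ℝ} (hε : 0 < ε) :
    ∃ G : M → ℝ, IsSmoothFunction G ∧ (∀ y, ‖manifoldGradient G y‖ ≤ (1 + ε) ^ 2 + ε) ∧
      ∀ y, |G y - intrinsicDist M x y| ≤ ε := by
  have hcoe : ((Real.toNNReal ((1 + ε) ^ 2) : NNReal) : ℝ) = (1 + ε) ^ 2 :=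
    Real.coe_toNNReal _ (by positivity)
  have := hM.exists_smooth_approx hK (fun y => intrinsicDist M x y)
    (K := Real.toNNReal ((1 + ε) ^ 2)) (fun z => ?_) hε
  · rwa [hcoe] at this
  obtain ⟨W, hW, hzW, h⟩ := hM.exists_open_pathLength_le z (κ := 1 + ε) (by linarith)
  refine ⟨W, hW, hzW, fun y z hy hz => ?_⟩
  obtain ⟨L, hL, hLle⟩ := h y z hy hz
  obtain ⟨L', hL', hLle'⟩ := h z y hz hy
  have h1 := hM.intrinsicDist_le_add hconn (x := x) hL
  have h2 := hM.intrinsicDist_le_add hconn (x := x) hL'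
  rw [norm_sub_rev] at hLle'
  rw [hcoe, abs_le]
  constructor <;> linarith

/-! ### The distance formula -/

theorem HasCharts.uniformNorm_le_one_iff (hM : HasCharts d M) (hK : IsCompact M)
    {Δ : SmoothFunctions M →ₗ[ℝ] SmoothFunctions M} (hΔ : IsLaplaceBeltrami d Δ)
    (f : SmoothFunctions M) :
    uniformNorm ((1 / 2 : ℝ) • Δ (f ^ 2) - f * Δ f).1 ≤ 1 ↔
      ∀ x, ‖manifoldGradient f.1 x‖ ≤ 1 := by
  rw [hM.carre_du_champ hK hΔ, uniformNorm, iSup_le_iff]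
  refine forall_congr' fun x => ?_
  rw [gradientInner, real_inner_self_eq_norm_sq, ← ofReal_norm, ENNReal.ofReal_le_one,
    Real.norm_of_nonneg (sq_nonneg _), sq_le_one_iff_abs_le_one, abs_norm]

theorem HasCharts.norm_manifoldGradient_smul (hM : HasCharts d M) {f : M → ℝ}
    (hf : IsSmoothFunction f) (a : ℝ) (x : M) :
    ‖manifoldGradient (a • f) x‖ = |a| * ‖manifoldGradient f x‖ := by
  have h1 : gradientInner (a • f) (a • f) x = a * (a * gradientInner f f x) := by
    rw [hM.gradientInner_smul_right ((SmoothFunctions M).smul_mem hf a) hf, gradientInner_comm,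
      hM.gradientInner_smul_right hf hf]
  rw [gradientInner, gradientInner, real_inner_self_eq_norm_sq, real_inner_self_eq_norm_sq] at h1
  rw [← sq_eq_sq₀ (norm_nonneg _) (by positivity), h1, mul_pow, sq_abs]
  ring

theorem HasCharts.isLUB_intrinsicDist (hM : HasCharts d M) (hK : IsCompact M)
    (hconn : IsConnected M) {Δ : SmoothFunctions M →ₗ[ℝ] SmoothFunctions M}
    (hΔ : IsLaplaceBeltrami d Δ) (x y : M) :
    IsLUB {r : ℝ | ∃ f : SmoothFunctions M,
        uniformNorm ((1 / 2 : ℝ) • Δ (f ^ 2) - f * Δ f).1 ≤ 1 ∧ r = |f.1 x - f.1 y|}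
      (intrinsicDist M x y) := by
  simp only [hM.uniformNorm_le_one_iff hK hΔ]
  constructor
  · rintro _ ⟨f, hf, rfl⟩
    exact le_csInf (hM.pathLengths_nonempty hconn x y) fun L hL => hM.sub_le_pathLength f.2 hf hL
  · intro b hb
    have hε : ∀ ε : ℝ, 0 < ε → intrinsicDist M x y ≤ ((1 + ε) ^ 2 + ε) * b + 2 * ε := by
      intro ε hε
      obtain ⟨G, hG, hgrad, hdist⟩ := hM.exists_smooth_approx_intrinsicDist hK hconn x hε
      -- `A` bounds the gradient of `G`, so `A⁻¹ • G` is admissible; the `2 * ε` is the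
      -- approximation error at the two points `x` and `y`.
      set A : ℝ := (1 + ε) ^ 2 + ε
      have hA : 0 < A := by positivity
      have h1 : |(A⁻¹ • G) x - (A⁻¹ • G) y| ≤ b := by
        refine hb ⟨⟨A⁻¹ • G, (SmoothFunctions M).smul_mem hG _⟩, fun z => ?_, rfl⟩
        rw [hM.norm_manifoldGradient_smul hG, abs_of_pos (inv_pos.2 hA), inv_mul_le_iff₀ hA, mul_one]
        exact hgrad z
      have h2 : |G x - G y| ≤ A * b := by
        rw [Pi.smul_apply, Pi.smul_apply, ← smul_sub, smul_eq_mul, abs_mul,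
          abs_of_pos (inv_pos.2 hA), inv_mul_le_iff₀ hA] at h1
        exact h1
      have h3 := abs_le.1 (hdist x)
      have h4 := abs_le.1 (hdist y)
      rw [intrinsicDist_self] at h3
      have h5 := abs_le.1 h2
      linarith
    have hlim : Tendsto (fun ε : ℝ => ((1 + ε) ^ 2 + ε) * b + 2 * ε) (𝓝[>] 0) (𝓝 b) := by
      have : Continuous fun ε : ℝ => ((1 + ε) ^ 2 + ε) * b + 2 * ε := by fun_prop
      simpa using (this.tendsto 0).mono_left nhdsWithin_le_nhds
    refine ge_of_tendsto hlim ?_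
    filter_upwards [self_mem_nhdsWithin] with ε h using hε ε h

end

end

theorem mainTheorem4 (n d : ℕ) (M : Set (EuclideanSpace ℝ (Fin (n + d))))
    (hM : IsSmoothSubmanifold n d M) (hcompact : IsCompact M) (hconn : IsConnected M) :
    (∃! Δ : SmoothFunctions M →ₗ[ℝ] SmoothFunctions M, IsLaplaceBeltrami d Δ) ∧
    ∀ Δ : SmoothFunctions M →ₗ[ℝ] SmoothFunctions M, IsLaplaceBeltrami d Δ →
      ∀ x y : M,
        IsLUB {r : ℝ | ∃ f : SmoothFunctions M,
            uniformNorm ((1 / 2 : ℝ) • Δ (f ^ 2) - f * Δ f).1 ≤ 1 ∧ r = |f.1 x - f.1 y|}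
          (intrinsicDist M x y) := by
  have hM' : HasCharts d M := exists_chart hM
  exact ⟨hM'.existsUnique_isLaplaceBeltrami hcompact, fun Δ hΔ x y =>
    hM'.isLUB_intrinsicDist hcompact hconn hΔ x y⟩
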